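/- **Lemma 2.1.** Let $d\ge 1$ and let $\Omega\subset\mathbb{R}^d$ be a bounded Lipschitz domain (bounded, open, connected, non-empty, and locally on one side of the graph of a Lipschitz function after a rotation of the coordinates). Let $|\cdot|$ and $d\sigma$ denote the $(d-1)$-dimensional surface measure on $\Gamma=\partial\Omega$, and let $\Gamma=\Gamma_D\cup\Gamma_R$ with $\Gamma_D,\Gamma_R$ disjoint and $\sigma$-measurable and $|\Gamma_R|>0$. All functions are complex valued; $(u,v)=\int_\Omega u\overline v$, $\|\cdot\|$ is the norm of $L^2(\Omega)$, $H^1(\Omega)$ is the usual Sobolev space with $\|u\|_{H^1(\Omega)}^2=\|u\|^2+\|\nabla u\|^2$, and $\gamma:H^1(\Omega)\to L^2(\Gamma)$ is the trace operator: $\gamma u=g$ if there are functions $\varphi_k\in C^\infty(\mathbb{R}^d)$ with $\varphi_k|_\Omega\to u$ in $H^1(\Omega)$ and $\varphi_k|_\Gamma\to g$ in $L^2(\Gamma)$. Let $V=\{u\in H^1(\Omega):\gamma u=0\ \ \sigma\text{-a.e. on }\Gamma_D\}$ (so $V=H^1(\Omega)$ if $|\Gamma_D|=0$). Let $\alpha_0>0$,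 let $a\in L^\infty(\Omega)$ satisfy $\operatorname*{ess\,inf}_{\Omega}\operatorname{Re}a\ge\alpha_0$, let $c\in L^\infty(\Gamma_R)$, and set $c_0=\operatorname*{ess\,inf}_{\Gamma_R}\operatorname{Re}c$ and $$A(u,v)=\int_\Omega a\,\nabla u\cdot\overline{\nabla v}\,dx+\int_{\Gamma_R}c\,\gamma u\,\overline{\gamma v}\,d\sigma .$$ Then every $u\in H^1(\Omega)$ has exactly one trace $\gamma u\in L^2(\Gamma)$, and there is a real constant $C_{\rm trace}$ with $$\|\gamma u\|_{L^2(\Gamma_R)}^2\le C_{\rm trace}\,\|u\|\,\|u\|_{H^1(\Omega)}\qquad\text{for all }u\in H^1(\Omega).\tag{1}$$ Moreover, for every real constant $C_{\rm trace}$ satisfying (1), put $$\Lambda=\begin{cases}0&\text{if }c_0\ge0\text{ and }|\Gamma_D|>0,\\ \alpha_0&\text{if }c_0\ge0\text{ and }|\Gamma_D|=0,\\ \alpha_0+\dfrac{C_{\rm trace}^2\,|c_0|^2}{\alpha_0}&\text{if }c_0<0.\end{cases}$$ Then there exist constants $C_{\rm cont},c_{\rm coer}>0$ such that $A_\Lambda(u,v):=A(u,v)+\Lambda\,(u,v)$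 satisfies $$|A_\Lambda(u,v)|\le C_{\rm cont}\|u\|_{H^1(\Omega)}\|v\|_{H^1(\Omega)}\quad\text{for all }u,v\in V,\qquad \operatorname{Re}A_\Lambda(u,u)\ge c_{\rm coer}\|u\|_{H^1(\Omega)}^2\quad\text{for all }u\in V.$$ -/

import Mathlib

open MeasureTheory Filter Topology
open scoped ENNReal ContDiff

noncomputable section

namespace RobinForm

/-- The Euclidean space of dimension `n + 1`; all dimensions `d = n + 1 ≥ 1` are covered. -/
abbrev Space (n : ℕ) : Type := EuclideanSpace ℝ (Fin (n + 1))

/-- Values of gradients of complex-valued functions on `Space n`. -/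
abbrev GradSpace (n : ℕ) : Type := EuclideanSpace ℂ (Fin (n + 1))

/-- A bounded Lipschitz domain: a bounded, connected, open, nonempty set which, near each of its
boundary points and after an orthogonal change of coordinates `T`, is the set of points lying
strictly above the graph of a Lipschitz function `ψ` of the first `n` coordinates. -/
structure IsLipschitzDomain {n : ℕ} (Ω : Set (Space n)) : Prop where
  isOpen : IsOpen Ω
  isConnected : IsConnected Ω
  isBounded : Bornology.IsBounded Ω
  lipschitz_boundary : ∀ p ∈ frontier Ω,
    ∃ (T : Space n ≃ₗᵢ[ℝ] Space n) (ψ : (Fin n → ℝ) → ℝ) (K : NNReal),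
      LipschitzWith K ψ ∧
        ∃ U ∈ 𝓝 p, ∀ x ∈ U, x ∈ Ω ↔ ψ (fun i => T x i.castSucc) < T x (Fin.last n)

/-- The surface measure on the boundary of `Ω`: the normalized `n`-dimensional Hausdorff measure
of the `(n + 1)`-dimensional Euclidean space, restricted to the boundary. -/
def surfaceMeasure {n : ℕ} (Ω : Set (Space n)) : Measure (Space n) :=
  (Measure.euclideanHausdorffMeasure n).restrict (frontier Ω)

/-- `G` is a weak gradient of `u` on `Ω`: integration by parts holds against every real-valued
smooth test function with compact support in `Ω`. -/
def IsWeakGradient {n : ℕ} (Ω : Set (Space n)) (u : Space n → ℂ) (G : Space n → GradSpace n) :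
    Prop :=
  ∀ φ : Space n → ℝ, ContDiff ℝ ∞ φ → HasCompactSupport φ → tsupport φ ⊆ Ω →
    ∀ i : Fin (n + 1),
      ∫ x in Ω, (fderiv ℝ φ x (EuclideanSpace.single i 1)) • u x = - ∫ x in Ω, φ x • G x i

/-- `L²(Ω; ℂ) × L²(Ω; ℂ^(n+1))` with the Hilbert norm `(‖u‖² + ‖G‖²)^(1/2)`. -/
abbrev PairSpace {n : ℕ} (Ω : Set (Space n)) : Type :=
  WithLp 2 (Lp ℂ 2 (volume.restrict Ω) × Lp (GradSpace n) 2 (volume.restrict Ω))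

theorem integrable_test_smul {n : ℕ} {Ω : Set (Space n)} {F : Type*} [NormedAddCommGroup F]
    [NormedSpace ℝ F] {g : Space n → ℝ} (hg : Continuous g) (hc : HasCompactSupport g)
    (f : Lp F 2 (volume.restrict Ω)) :
    Integrable (fun x => g x • f x) (volume.restrict Ω) := by
  have h1 : MemLp g 2 (volume.restrict Ω) := (hg.memLp_of_hasCompactSupport hc).restrict Ω
  exact memLp_one_iff_integrable.1 ((Lp.memLp f).smul h1)

/-- The Sobolev space `H¹(Ω)` of complex-valued functions. An element is a function `u ∈ L²(Ω)`
together with its weak gradient `∇u ∈ L²(Ω)`, which `u` determines for open `Ω`; the norm inherited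
from `PairSpace Ω` is the usual one, `‖u‖²_{H¹} = ‖u‖² + ‖∇u‖²`. -/
def H1 {n : ℕ} (Ω : Set (Space n)) : Submodule ℂ (PairSpace Ω) where
  carrier := {p | IsWeakGradient Ω p.fst p.snd}
  zero_mem' := by
    intro φ hφ hc hs i
    have h1 : (fun x => (fderiv ℝ φ x (EuclideanSpace.single i 1)) •
        ((0 : Lp ℂ 2 (volume.restrict Ω)) : Space n → ℂ) x) =ᵐ[volume.restrict Ω] 0 := by
      filter_upwards [Lp.coeFn_zero ℂ 2 (volume.restrict Ω)] with x hx
      rw [hx, Pi.zero_apply, smul_zero]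
    have h2 : (fun x => φ x •
        ((0 : Lp (GradSpace n) 2 (volume.restrict Ω)) : Space n → GradSpace n) x i)
          =ᵐ[volume.restrict Ω] 0 := by
      filter_upwards [Lp.coeFn_zero (GradSpace n) 2 (volume.restrict Ω)] with x hx
      rw [hx, Pi.zero_apply, PiLp.zero_apply, smul_zero]; rfl
    simp only [WithLp.zero_fst, WithLp.zero_snd]
    rw [integral_congr_ae h1, integral_congr_ae h2]
    simp
  add_mem' := by
    intro p q hp hq φ hφ hc hs i
    have hd : Continuous fun x => fderiv ℝ φ x (EuclideanSpace.single i 1) :=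
      (hφ.continuous_fderiv (by simp)).clm_apply continuous_const
    have hdc : HasCompactSupport fun x => fderiv ℝ φ x (EuclideanSpace.single i 1) :=
      hc.fderiv_apply ℝ _
    have e1 : (fun x => (fderiv ℝ φ x (EuclideanSpace.single i 1)) •
        ((p + q).fst : Space n → ℂ) x) =ᵐ[volume.restrict Ω]
        fun x => (fderiv ℝ φ x (EuclideanSpace.single i 1)) • (p.fst : Space n → ℂ) x +
          (fderiv ℝ φ x (EuclideanSpace.single i 1)) • (q.fst : Space n → ℂ) x := by
      rw [WithLp.add_fst]
      filter_upwards [Lp.coeFn_add p.fst q.fst] with x hx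
      rw [hx, Pi.add_apply, smul_add]
    have e2 : (fun x => φ x • ((p + q).snd : Space n → GradSpace n) x i) =ᵐ[volume.restrict Ω]
        fun x => φ x • (p.snd : Space n → GradSpace n) x i +
          φ x • (q.snd : Space n → GradSpace n) x i := by
      rw [WithLp.add_snd]
      filter_upwards [Lp.coeFn_add p.snd q.snd] with x hx
      rw [hx, Pi.add_apply, PiLp.add_apply, smul_add]
    have hi : ∀ r : PairSpace Ω, Integrable
        (fun x => φ x • (r.snd : Space n → GradSpace n) x i) (volume.restrict Ω) := fun r =>
      ((EuclideanSpace.proj i : GradSpace n →L[ℂ] ℂ).restrictScalars ℝ).integrable_comp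
        (integrable_test_smul hφ.continuous hc r.snd)
    rw [integral_congr_ae e1, integral_congr_ae e2,
      integral_add (integrable_test_smul hd hdc _) (integrable_test_smul hd hdc _),
      integral_add (hi p) (hi q), hp φ hφ hc hs i, hq φ hφ hc hs i]
    ring
  smul_mem' := by
    intro c p hp φ hφ hc hs i
    have e1 : (fun x => (fderiv ℝ φ x (EuclideanSpace.single i 1)) •
        ((c • p).fst : Space n → ℂ) x) =ᵐ[volume.restrict Ω]
        fun x => c • ((fderiv ℝ φ x (EuclideanSpace.single i 1)) • (p.fst : Space n → ℂ) x) := by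
      rw [WithLp.smul_fst]
      filter_upwards [Lp.coeFn_smul c p.fst] with x hx
      rw [hx, Pi.smul_apply, smul_comm]
    have e2 : (fun x => φ x • ((c • p).snd : Space n → GradSpace n) x i) =ᵐ[volume.restrict Ω]
        fun x => c • (φ x • (p.snd : Space n → GradSpace n) x i) := by
      rw [WithLp.smul_snd]
      filter_upwards [Lp.coeFn_smul c p.snd] with x hx
      rw [hx, Pi.smul_apply, PiLp.smul_apply, smul_comm]
    rw [integral_congr_ae e1, integral_congr_ae e2, integral_smul, integral_smul,
      hp φ hφ hc hs i, smul_neg]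

/-- The function underlying an element of `H¹(Ω)`. -/
def fn {n : ℕ} {Ω : Set (Space n)} (u : H1 Ω) : Lp ℂ 2 (volume.restrict Ω) :=
  (u : PairSpace Ω).fst

/-- The weak gradient of an element of `H¹(Ω)`. -/
def grad {n : ℕ} {Ω : Set (Space n)} (u : H1 Ω) : Lp (GradSpace n) 2 (volume.restrict Ω) :=
  (u : PairSpace Ω).snd

/-- The classical gradient of a complex-valued function on `Space n`. -/
def classicalGrad {n : ℕ} (φ : Space n → ℂ) (x : Space n) : GradSpace n :=
  WithLp.toLp 2 fun i => fderiv ℝ φ x (EuclideanSpace.single i 1)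

/-- `g ∈ L²(∂Ω)` is a trace of `u ∈ H¹(Ω)`: some sequence of smooth functions on the whole space
converges to `u` in `H¹(Ω)` while its restrictions to the boundary converge to `g` in `L²(∂Ω)`.
This is the graph of the continuous extension to `H¹(Ω)` of the restriction `φ ↦ φ|_∂Ω`. -/
def IsTrace {n : ℕ} (Ω : Set (Space n)) (u : H1 Ω) (g : Lp ℂ 2 (surfaceMeasure Ω)) : Prop :=
  ∃ φ : ℕ → Space n → ℂ, (∀ k, ContDiff ℝ ∞ (φ k)) ∧
    Tendsto (fun k => eLpNorm (fun x => φ k x - fn u x) 2 (volume.restrict Ω)) atTop (𝓝 0) ∧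
    Tendsto (fun k => eLpNorm (fun x => classicalGrad (φ k) x - grad u x) 2 (volume.restrict Ω))
      atTop (𝓝 0) ∧
    Tendsto (fun k => eLpNorm (fun x => φ k x - g x) 2 (surfaceMeasure Ω)) atTop (𝓝 0)

/-- The trace operator `γ : H¹(Ω) → L²(∂Ω)`. -/
def trace {n : ℕ} (Ω : Set (Space n)) (u : H1 Ω) : Lp ℂ 2 (surfaceMeasure Ω) :=
  Classical.epsilon (IsTrace Ω u)

/-- The set `V` of all `u ∈ H¹(Ω)` whose trace vanishes almost everywhere on `Γ_D`. It is the whole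
of `H¹(Ω)` if `Γ_D` is empty. -/
def V {n : ℕ} (Ω ΓD : Set (Space n)) : Set (H1 Ω) :=
  {u | ∀ᵐ x ∂(surfaceMeasure Ω).restrict ΓD, trace Ω u x = 0}

/-- The multiplicative trace inequality
`‖γ u‖²_{L²(Γ_R)} ≤ C ‖u‖_{L²(Ω)} ‖u‖_{H¹(Ω)}` for all `u ∈ H¹(Ω)`. -/
def MultTraceIneq {n : ℕ} (Ω ΓR : Set (Space n)) (C : ℝ) : Prop :=
  ∀ u : H1 Ω, ∫ x in ΓR, ‖trace Ω u x‖ ^ 2 ∂(surfaceMeasure Ω) ≤ C * ‖fn u‖ * ‖u‖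

/-- The form `A(u, v) = (a ∇u, ∇v) + (c u, v)_{L²(Γ_R)}`, antilinear in `v`. -/
def form {n : ℕ} (Ω ΓR : Set (Space n)) (a c : Space n → ℂ) (u v : H1 Ω) : ℂ :=
  (∫ x in Ω, a x * ∑ i, grad u x i * star (grad v x i)) +
    ∫ x in ΓR, c x * trace Ω u x * star (trace Ω v x) ∂(surfaceMeasure Ω)

/-- The shifted form `A_Λ(u, v) = A(u, v) + Λ (u, v)`. -/
def shiftedForm {n : ℕ} (Ω ΓR : Set (Space n)) (a c : Space n → ℂ) (L : ℝ) (u v : H1 Ω) : ℂ :=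
  form Ω ΓR a c u v + L * ∫ x in Ω, fn u x * star (fn v x)

/-- The essential infimum `c₀` of `Re c` over `Γ_R` with respect to the surface measure. -/
def robinInf {n : ℕ} (Ω ΓR : Set (Space n)) (c : Space n → ℂ) : ℝ :=
  essInf (fun x => (c x).re) ((surfaceMeasure Ω).restrict ΓR)

open Classical in
/-- The shift `Λ`, as a function of `α₀`, `c₀`, a trace constant `C` and the surface measure `mD`
of `Γ_D`. -/
def shift (α₀ c₀ C : ℝ) (mD : ℝ≥0∞) : ℝ :=
  if c₀ < 0 then α₀ + C ^ 2 * |c₀| ^ 2 / α₀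
  else if 0 < mD then 0
  else α₀

end RobinForm

end

namespace RobinForm

/-! Everything is proved for smooth functions on the whole space and carried to `H1 Ω` by density.
Three facts about a bounded Lipschitz domain are needed.

Trace inequality. Near a boundary point the boundary is a Lipschitz graph, and the segments rising
from it stay in the domain. The fundamental theorem of calculus for `φ ^ 2` along these segments,
averaged over the height and integrated over the graph, bounds the boundary integral of `|φ|²` by
the integrals of `|φ|²` and `|φ| |∇φ|`; compactness of the boundary makes this global
(`exists_smooth_trace_le`). The product structure of the last term is what makes the inequality
multiplicative.

Density. After a partition of unity, `u` is mollified with a kernel pushed along the interior cone,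
so that the values used at a point of the domain come from a ball inside it; there the weak gradient
can be tested against the kernel (`smoothApprox_cutoff`, `smoothApprox`). With the trace inequality,
boundary values of approximating sequences are Cauchy in `L²` and their limit depends only on `u`:
traces exist, are unique and inherit the inequality.

Friedrichs inequality. The Poincaré inequality is proved constructively as a bound for the double
integral of `|φ x - φ y|²` (`OscBound`): on balls by convexity, near the closure by shifting along
the cone, globally by chaining through overlapping neighbourhoods, using connectedness and
compactness. The trace inequality for `φ - φ y`, integrated in `y`, then gives control by the
gradient and by the boundary values on any set of positive measure.

The form is bounded by Cauchy–Schwarz and the trace bound. For coercivity, `Re A_Λ(u,u)` is at least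
`α₀ ‖∇u‖² + c₀ ‖γu‖² + Λ ‖u‖²`. If `c₀ < 0`, the trace inequality and a completed square absorb the
boundary term into the shift. If `c₀ ≥ 0`, that term is dropped, and the mass part comes from
Friedrichs or from `Λ = α₀`. -/

/-! ### Smooth functions along segments and under translation -/

theorem continuous_classicalGrad {n : ℕ} {φ : Space n → ℂ} (hφ : ContDiff ℝ ∞ φ) :
    Continuous (classicalGrad φ) := by
  unfold classicalGrad
  refine (PiLp.continuous_toLp 2 _).comp (continuous_pi fun i => ?_)
  exact (hφ.continuous_fderiv (by simp)).clm_apply continuous_const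

/-- Expand `e` in the standard basis and apply Cauchy–Schwarz to its real coordinates and the
complex partial derivatives. -/
theorem norm_fderiv_apply_le {n : ℕ} (φ : Space n → ℂ) (x e : Space n) :
    ‖fderiv ℝ φ x e‖ ≤ ‖e‖ * ‖classicalGrad φ x‖ := by
  have he : e = ∑ i, e i • EuclideanSpace.single i (1 : ℝ) := by
    ext j
    simp [Finset.sum_apply, Pi.single_apply]
  conv_lhs => rw [he]
  rw [map_sum]
  refine (norm_sum_le _ _).trans ?_
  simp only [map_smul, norm_smul]
  refine (Real.sum_mul_le_sqrt_mul_sqrt _ _ _).trans (le_of_eq ?_)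
  rw [EuclideanSpace.norm_eq, EuclideanSpace.norm_eq]
  rfl

theorem enorm_fderiv_apply_le {n : ℕ} (φ : Space n → ℂ) (x e : Space n) :
    ‖fderiv ℝ φ x e‖ₑ ≤ ‖e‖ₑ * ‖classicalGrad φ x‖ₑ := by
  rw [← ofReal_norm, ← ofReal_norm, ← ofReal_norm,
    ← ENNReal.ofReal_mul (norm_nonneg _)]
  exact ENNReal.ofReal_le_ofReal (norm_fderiv_apply_le φ x e)

theorem enorm_add_smul_sub_le_lintegral {E : Type*} [NormedAddCommGroup E] [NormedSpace ℝ E]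
    {f : E → ℂ} (hf : ContDiff ℝ 1 f) (x h : E) {r : ℝ} (hr : 0 ≤ r) :
    ‖f (x + r • h) - f x‖ₑ ≤ ∫⁻ t in Set.Ioc (0 : ℝ) r, ‖fderiv ℝ f (x + t • h) h‖ₑ := by
  have hd : ∀ t ∈ Set.uIcc (0 : ℝ) r,
      HasDerivAt (fun t : ℝ => f (x + t • h)) (fderiv ℝ f (x + t • h) h) t := by
    intro t _
    have h1 : HasDerivAt (fun t : ℝ => x + t • h) h t := by
      simpa using ((hasDerivAt_id t).smul_const h).const_add x
    exact ((hf.differentiable one_ne_zero).differentiableAt.hasFDerivAt).comp_hasDerivAt t h1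
  have hc : Continuous fun t : ℝ => fderiv ℝ f (x + t • h) h :=
    ((hf.continuous_fderiv one_ne_zero).comp (by fun_prop)).clm_apply continuous_const
  have key := intervalIntegral.integral_eq_sub_of_hasDerivAt hd (hc.intervalIntegrable 0 r)
  simp only [zero_smul, add_zero] at key
  rw [← key, intervalIntegral.integral_of_le hr]
  exact enorm_integral_le_lintegral_enorm _

theorem enorm_add_sub_le_lintegral {E : Type*} [NormedAddCommGroup E] [NormedSpace ℝ E]
    {f : E → ℂ} (hf : ContDiff ℝ 1 f) (x h : E) :
    ‖f (x + h) - f x‖ₑ ≤ ∫⁻ t in Set.Icc (0 : ℝ) 1, ‖fderiv ℝ f (x + t • h) h‖ₑ := by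
  have := enorm_add_smul_sub_le_lintegral hf x h zero_le_one
  rw [one_smul] at this
  exact this.trans (lintegral_mono_set Set.Ioc_subset_Icc_self)

theorem sq_lintegral_mul_le {α : Type*} [MeasurableSpace α] {μ : Measure α} {f g : α → ℝ≥0∞}
    (hf : AEMeasurable f μ) (hg : AEMeasurable g μ) :
    (∫⁻ x, f x * g x ∂μ) ^ 2 ≤ (∫⁻ x, f x ^ 2 ∂μ) * ∫⁻ x, g x ^ 2 ∂μ := by
  have h := ENNReal.lintegral_mul_le_Lp_mul_Lq μ Real.HolderConjugate.two_two hf hg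
  simp only [Pi.mul_apply, ENNReal.rpow_two] at h
  refine (pow_le_pow_left₀ zero_le h 2).trans (le_of_eq ?_)
  rw [mul_pow, ← ENNReal.rpow_natCast, ← ENNReal.rpow_natCast, ← ENNReal.rpow_mul,
    ← ENNReal.rpow_mul]
  norm_num

theorem sq_lintegral_le {α : Type*} [MeasurableSpace α] {μ : Measure α} {f : α → ℝ≥0∞}
    (hf : AEMeasurable f μ) : (∫⁻ x, f x ∂μ) ^ 2 ≤ μ Set.univ * ∫⁻ x, f x ^ 2 ∂μ := by
  simpa using sq_lintegral_mul_le (f := fun _ => 1) (μ := μ) aemeasurable_const hf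

/-- Write the difference as an integral of the derivative over `[0, 1]`, apply Cauchy–Schwarz in `t`
and exchange the integrals. For fixed `t` the translation by `t • h` preserves volume and carries
`A` into `Ω`. -/
theorem lintegral_shift_sub_sq_le {n : ℕ} {φ : Space n → ℂ} (hφ : ContDiff ℝ ∞ φ)
    {A Ω : Set (Space n)} (hA : MeasurableSet A) (hΩ : MeasurableSet Ω) (h : Space n)
    (hAΩ : ∀ x ∈ A, ∀ t ∈ Set.Icc (0 : ℝ) 1, x + t • h ∈ Ω) :
    ∫⁻ x in A, ‖φ (x + h) - φ x‖ₑ ^ 2 ≤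
      ‖h‖ₑ ^ 2 * ∫⁻ x in Ω, ‖classicalGrad φ x‖ₑ ^ 2 := by
  have hcg := continuous_classicalGrad hφ
  have h1 : ∀ x, ‖φ (x + h) - φ x‖ₑ ^ 2 ≤
      ∫⁻ t in Set.Icc (0 : ℝ) 1, ‖h‖ₑ ^ 2 * ‖classicalGrad φ (x + t • h)‖ₑ ^ 2 := by
    intro x
    refine (pow_le_pow_left₀ zero_le
      (enorm_add_sub_le_lintegral (hφ.of_le (by simp)) x h) 2).trans ?_
    have hc : Continuous fun t : ℝ => fderiv ℝ φ (x + t • h) h :=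
      ((hφ.continuous_fderiv (by simp)).comp (by fun_prop)).clm_apply continuous_const
    refine (sq_lintegral_le hc.enorm.aemeasurable).trans ?_
    simp only [Measure.restrict_apply, MeasurableSet.univ, Set.univ_inter, Real.volume_Icc,
      sub_zero, ENNReal.ofReal_one, one_mul]
    refine lintegral_mono fun t => ?_
    rw [← mul_pow]
    exact pow_le_pow_left₀ zero_le (enorm_fderiv_apply_le _ _ _) 2
  refine (lintegral_mono h1).trans ?_
  rw [lintegral_lintegral_swap]
  · calc _ ≤ ∫⁻ t in Set.Icc (0 : ℝ) 1,
          ‖h‖ₑ ^ 2 * ∫⁻ x in Ω, ‖classicalGrad φ x‖ₑ ^ 2 := by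
          refine setLIntegral_mono' measurableSet_Icc fun t ht => ?_
          rw [lintegral_const_mul' _ _ (by simp)]
          refine mul_le_mul_right ?_ _
          rw [← lintegral_indicator hA, ← lintegral_indicator hΩ,
            
            ← lintegral_add_right_eq_self (Ω.indicator _) (t • h)]
          refine lintegral_mono fun x => ?_
          by_cases hx : x ∈ A
          · rw [Set.indicator_of_mem hx, Set.indicator_of_mem (hAΩ x hx t ht)]
          · rw [Set.indicator_of_notMem hx]
            exact zero_le
      _ = _ := by simp
  · refine Measurable.aemeasurable ?_
    have : Continuous fun p : Space n × ℝ => classicalGrad φ (p.1 + p.2 • h) :=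
      hcg.comp (by fun_prop)
    exact (this.enorm.measurable.pow_const 2).const_mul _

/-! ### Graph coordinates and the interior cone property -/

/-- The first `n` coordinates of `x` in the rotated coordinate system `T`. -/
noncomputable def baseCoord {n : ℕ} (T : Space n ≃ₗᵢ[ℝ] Space n) (x : Space n) : Fin n → ℝ :=
  fun i => T x i.castSucc

/-- The last coordinate of `x` in the rotated coordinate system `T`. -/
noncomputable def height {n : ℕ} (T : Space n ≃ₗᵢ[ℝ] Space n) (x : Space n) : ℝ := T x (Fin.last n)

/-- The upward unit vector of the rotated coordinate system `T`. -/
noncomputable def upDir {n : ℕ} (T : Space n ≃ₗᵢ[ℝ] Space n) : Space n :=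
  T.symm (EuclideanSpace.single (Fin.last n) 1)

section Chart

variable {n : ℕ} (T : Space n ≃ₗᵢ[ℝ] Space n)

theorem norm_upDir : ‖upDir T‖ = 1 := by
  simp [upDir]

theorem baseCoord_add_smul (x : Space n) (s : ℝ) :
    baseCoord T (x + s • upDir T) = baseCoord T x := by
  funext i
  simp [baseCoord, upDir, Fin.castSucc_ne_last]

theorem height_add_smul (x : Space n) (s : ℝ) :
    height T (x + s • upDir T) = height T x + s := by
  simp [height, upDir]

theorem abs_height_sub_le (x y : Space n) : |height T x - height T y| ≤ dist x y := by
  rw [dist_eq_norm, ← T.norm_map, map_sub]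
  exact PiLp.norm_apply_le (T x - T y) (Fin.last n)

theorem dist_baseCoord_le (x y : Space n) : dist (baseCoord T x) (baseCoord T y) ≤ dist x y := by
  rw [dist_pi_le_iff dist_nonneg]
  intro i
  rw [dist_eq_norm x, ← T.norm_map, map_sub]
  exact PiLp.norm_apply_le (T x - T y) i.castSucc

theorem continuous_baseCoord : Continuous (baseCoord T) :=
  (LipschitzWith.of_dist_le_mul (K := 1) fun x y => by
    simpa using dist_baseCoord_le T x y).continuous

theorem continuous_height : Continuous (height T) :=
  (LipschitzWith.of_dist_le_mul (K := 1) fun x y => by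
    simpa [Real.dist_eq] using abs_height_sub_le T x y).continuous

end Chart

theorem IsLipschitzDomain.exists_chart {n : ℕ} {Ω : Set (Space n)} (hΩ : IsLipschitzDomain Ω)
    {p : Space n} (hp : p ∈ frontier Ω) :
    ∃ (T : Space n ≃ₗᵢ[ℝ] Space n) (ψ : (Fin n → ℝ) → ℝ) (K : NNReal) (ρ : ℝ),
      LipschitzWith K ψ ∧ 0 < ρ ∧
        ∀ x ∈ Metric.ball p ρ, x ∈ Ω ↔ ψ (baseCoord T x) < height T x := by
  obtain ⟨T, ψ, K, hψ, U, hU, h⟩ := hΩ.lipschitz_boundary p hp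
  obtain ⟨ρ, hρ, hρU⟩ := Metric.mem_nhds_iff.1 hU
  exact ⟨T, ψ, K, ρ, hψ, hρ, fun x hx => h x (hρU hx)⟩

/-- The uniform interior cone property of a Lipschitz domain. -/
theorem IsLipschitzDomain.exists_cone {n : ℕ} {Ω : Set (Space n)} (hΩ : IsLipschitzDomain Ω)
    {p : Space n} (hp : p ∈ closure Ω) :
    ∃ (e : Space n) (r δ : ℝ), ‖e‖ ≤ 1 ∧ 0 < r ∧ 0 < δ ∧ δ ≤ 1 ∧
      ∀ x ∈ Ω, x ∈ Metric.ball p r → ∀ s, 0 < s → s < r →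
        Metric.ball (x + s • e) (δ * s) ⊆ Ω := by
  by_cases hpΩ : p ∈ Ω
  · obtain ⟨ρ, hρ, hρΩ⟩ := Metric.isOpen_iff.1 hΩ.isOpen p hpΩ
    -- At an interior point no direction is needed: small balls about `x` itself already lie in `Ω`.
    refine ⟨0, ρ / 2, 1, by simp, by positivity, one_pos, le_rfl, fun x _ hxp s _ hs y hy =>
      hρΩ ?_⟩
    rw [smul_zero, add_zero, one_mul] at hy
    rw [Metric.mem_ball] at *
    linarith [dist_triangle y x p]
  · have hpf : p ∈ frontier Ω := by
      rw [frontier, hΩ.isOpen.interior_eq]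
      exact ⟨hp, hpΩ⟩
    obtain ⟨T, ψ, K, ρ, hψ, hρ, hch⟩ := hΩ.exists_chart hpf
    have hK : (0 : ℝ) ≤ K := K.2
    have hδ1 : 1 / (1 + (K : ℝ)) ≤ 1 := by
      rw [div_le_one (by positivity)]; linarith
    -- Rising by `s` gains `s` in height above the graph. A further displacement `d` costs at most
    -- `(1 + K) d`, which is less than `s` if `d < s / (1 + K)`. The radius `ρ / 3` keeps all points
    -- in the chart, since `ρ/3 + s + d < ρ`.
    refine ⟨upDir T, ρ / 3, 1 / (1 + K), (norm_upDir T).le, by positivity, by positivity, hδ1, ?_⟩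
    intro x hxΩ hxp s hs hsr y hy
    rw [Metric.mem_ball] at hy hxp
    have hxT : dist (x + s • upDir T) x = s := by
      rw [dist_eq_norm, add_sub_cancel_left, norm_smul, norm_upDir, mul_one,
        Real.norm_of_nonneg hs.le]
    have hδs : 1 / (1 + (K : ℝ)) * s ≤ s := by nlinarith
    have hyρ : y ∈ Metric.ball p ρ := by
      rw [Metric.mem_ball]
      linarith [dist_triangle4 y (x + s • upDir T) x p]
    rw [hch y hyρ]
    have hx := (hch x (by rw [Metric.mem_ball]; linarith)).1 hxΩ
    have h1 := abs_height_sub_le T y (x + s • upDir T)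
    have h2 := dist_baseCoord_le T y (x + s • upDir T)
    have h3 := hψ.dist_le_mul (baseCoord T y) (baseCoord T (x + s • upDir T))
    rw [height_add_smul] at h1
    rw [baseCoord_add_smul] at h2 h3
    rw [Real.dist_eq] at h3
    have h4 : (K : ℝ) * dist (baseCoord T y) (baseCoord T x)
        ≤ K * dist y (x + s • upDir T) := mul_le_mul_of_nonneg_left h2 hK
    have h5 : (1 + (K : ℝ)) * dist y (x + s • upDir T) < s := by
      have := mul_lt_mul_of_pos_left hy (show (0 : ℝ) < 1 + K by positivity)
      rwa [← mul_assoc, mul_one_div_cancel (by positivity), one_mul] at this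
    linarith [(abs_le.1 h1).1, (abs_le.1 h3).2]

/-! ### The Poincaré inequality in oscillation form -/

theorem ennreal_add_sq_le (a b : ℝ≥0∞) : (a + b) ^ 2 ≤ 2 * (a ^ 2 + b ^ 2) := by
  have h := ENNReal.rpow_add_le_mul_rpow_add_rpow a b (p := 2) (by norm_num)
  norm_num at h
  exact h

theorem enorm_sub_sq_le {F : Type*} [NormedAddCommGroup F] (a b c : F) :
    ‖a - c‖ₑ ^ 2 ≤ 2 * (‖a - b‖ₑ ^ 2 + ‖b - c‖ₑ ^ 2) := by
  refine le_trans (pow_le_pow_left₀ zero_le ?_ 2) (ennreal_add_sq_le _ _)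
  rw [← sub_add_sub_cancel a b c]
  exact enorm_add_le _ _

/-- The oscillation of smooth functions between `A` and `B` is controlled by the gradient
on `Ω`. -/
def OscBound {n : ℕ} (Ω A B : Set (Space n)) : Prop :=
  ∃ C : ℝ≥0∞, C ≠ ⊤ ∧ ∀ φ : Space n → ℂ, ContDiff ℝ ∞ φ →
    ∫⁻ x in A, ∫⁻ y in B, ‖φ x - φ y‖ₑ ^ 2 ≤ C * ∫⁻ x in Ω, ‖classicalGrad φ x‖ₑ ^ 2

section OscBound

variable {n : ℕ} {Ω A B D : Set (Space n)}

theorem measurable_enorm_sub_sq {φ : Space n → ℂ} (hφ : Continuous φ) :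
    Measurable fun p : Space n × Space n => ‖φ p.1 - φ p.2‖ₑ ^ 2 := by
  have h : Continuous fun p : Space n × Space n => φ p.1 - φ p.2 := by fun_prop
  exact h.enorm.measurable.pow_const 2

theorem OscBound.symm (h : OscBound Ω A B) : OscBound Ω B A := by
  obtain ⟨C, hC, h⟩ := h
  refine ⟨C, hC, fun φ hφ => le_trans (le_of_eq ?_) (h φ hφ)⟩
  rw [lintegral_lintegral_swap (measurable_enorm_sub_sq hφ.continuous).aemeasurable]
  simp only [enorm_sub_rev]

theorem OscBound.mono {A' B' : Set (Space n)} (h : OscBound Ω A B) (hA : A' ⊆ A) (hB : B' ⊆ B) :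
    OscBound Ω A' B' := by
  obtain ⟨C, hC, h⟩ := h
  refine ⟨C, hC, fun φ hφ => le_trans ?_ (h φ hφ)⟩
  exact (lintegral_mono fun x => lintegral_mono_set hB).trans (lintegral_mono_set hA)

theorem OscBound.union_left (hA : OscBound Ω A D) (hB : OscBound Ω B D) :
    OscBound Ω (A ∪ B) D := by
  obtain ⟨C₁, hC₁, h₁⟩ := hA
  obtain ⟨C₂, hC₂, h₂⟩ := hB
  refine ⟨C₁ + C₂, by simp [hC₁, hC₂], fun φ hφ => ?_⟩
  rw [add_mul]
  exact (lintegral_union_le _ _ _).trans (add_le_add (h₁ φ hφ) (h₂ φ hφ))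

/-- Average `|φ x - φ z|² ≤ 2 (|φ x - φ y|² + |φ y - φ z|²)` over an intermediate point `y` of `B`.
-/
theorem volume_mul_lintegral_osc_le {φ : Space n → ℂ} (hφ : Continuous φ) (hB : volume B ≠ ⊤)
    (hD : volume D ≠ ⊤) :
    volume B * ∫⁻ x in A, ∫⁻ z in D, ‖φ x - φ z‖ₑ ^ 2 ≤
      2 * (volume D * (∫⁻ x in A, ∫⁻ y in B, ‖φ x - φ y‖ₑ ^ 2) +
        volume A * ∫⁻ y in B, ∫⁻ z in D, ‖φ y - φ z‖ₑ ^ 2) := by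
  have hm : ∀ x, Measurable fun y => ‖φ x - φ y‖ₑ ^ 2 := fun x => by
    have h : Continuous fun y => φ x - φ y := by fun_prop
    exact h.enorm.measurable.pow_const 2
  have hpt : ∀ x, volume B * ∫⁻ z in D, ‖φ x - φ z‖ₑ ^ 2 ≤
      2 * (volume D * (∫⁻ y in B, ‖φ x - φ y‖ₑ ^ 2) +
        ∫⁻ y in B, ∫⁻ z in D, ‖φ y - φ z‖ₑ ^ 2) := by
    intro x
    calc volume B * ∫⁻ z in D, ‖φ x - φ z‖ₑ ^ 2
        = ∫⁻ y in B, ∫⁻ z in D, ‖φ x - φ z‖ₑ ^ 2 := by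
          rw [setLIntegral_const, mul_comm]
      _ ≤ ∫⁻ y in B, ∫⁻ z in D, 2 * (‖φ x - φ y‖ₑ ^ 2 + ‖φ y - φ z‖ₑ ^ 2) :=
          lintegral_mono fun y => lintegral_mono fun z => enorm_sub_sq_le _ _ _
      _ = ∫⁻ y in B, 2 * (volume D * ‖φ x - φ y‖ₑ ^ 2 +
            ∫⁻ z in D, ‖φ y - φ z‖ₑ ^ 2) := by
          refine lintegral_congr fun y => ?_
          rw [lintegral_const_mul' 2 _ (by simp), lintegral_add_left measurable_const,
            setLIntegral_const, mul_comm (volume D)]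
      _ = _ := by
          rw [lintegral_const_mul' _ _ (by simp),
            lintegral_add_left (Measurable.const_mul (hm x) (volume D)),
            lintegral_const_mul' _ _ hD]
  rw [← lintegral_const_mul' _ _ hB]
  refine (lintegral_mono hpt).trans (le_of_eq ?_)
  rw [lintegral_const_mul' _ _ (by simp), lintegral_add_right _ measurable_const,
    lintegral_const_mul' _ _ hD, setLIntegral_const, mul_comm (volume A)]

/-- The chaining step: dividing by the volume of the intermediate set `B` is what forces the overlap
of neighbouring sets to have positive measure. -/
theorem OscBound.trans (h₁ : OscBound Ω A B) (h₂ : OscBound Ω B D) (hA : volume A ≠ ⊤)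
    (hB : volume B ≠ ⊤) (hB0 : volume B ≠ 0) (hD : volume D ≠ ⊤) : OscBound Ω A D := by
  obtain ⟨C₁, hC₁, h₁⟩ := h₁
  obtain ⟨C₂, hC₂, h₂⟩ := h₂
  refine ⟨(volume B)⁻¹ * (2 * (volume D * C₁ + volume A * C₂)), ?_, fun φ hφ => ?_⟩
  · exact ENNReal.mul_ne_top (ENNReal.inv_ne_top.2 hB0) (ENNReal.mul_ne_top (by simp)
      (ENNReal.add_ne_top.2 ⟨ENNReal.mul_ne_top hD hC₁, ENNReal.mul_ne_top hA hC₂⟩))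
  have key := volume_mul_lintegral_osc_le (A := A) hφ.continuous hB hD
  have h₁' := h₁ φ hφ
  have h₂' := h₂ φ hφ
  generalize ∫⁻ x in Ω, ‖classicalGrad φ x‖ₑ ^ 2 = G at *
  generalize ∫⁻ x in A, ∫⁻ z in D, ‖φ x - φ z‖ₑ ^ 2 = X at *
  generalize volume A = a at *
  generalize volume B = b at *
  generalize volume D = d at *
  calc X = b⁻¹ * (b * X) := by rw [← mul_assoc, ENNReal.inv_mul_cancel hB0 hB, one_mul]
    _ ≤ b⁻¹ * (2 * (d * (C₁ * G) + a * (C₂ * G))) := by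
        refine mul_le_mul_right (key.trans ?_) _
        exact mul_le_mul_right (add_le_add (mul_le_mul_right h₁' _) (mul_le_mul_right h₂' _)) _
    _ = _ := by ring

/-- The Poincaré inequality on balls. -/
theorem oscBound_ball (hΩ : MeasurableSet Ω) (x₀ : Space n) (r : ℝ)
    (hB : Metric.ball x₀ r ⊆ Ω) : OscBound Ω (Metric.ball x₀ r) (Metric.ball x₀ r) := by
  set B := Metric.ball x₀ r with hBdef
  have hBm : MeasurableSet B := measurableSet_ball
  -- In the variable `h = y - x`, only shifts with `‖h‖ < 2 * r` contribute. Each costs at most `(2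
  -- * r) ^ 2` times the gradient integral, because segments in the ball stay in `Ω`.
  refine ⟨ENNReal.ofReal (2 * r) ^ 2 * volume (Metric.ball (0 : Space n) (2 * r)), ?_,
    fun φ hφ => ?_⟩
  · exact ENNReal.mul_ne_top (ENNReal.pow_ne_top ENNReal.ofReal_ne_top) measure_ball_lt_top.ne
  set G := ∫⁻ x in Ω, ‖classicalGrad φ x‖ₑ ^ 2
  have hφc := hφ.continuous
  have hm : Measurable fun p : Space n × Space n =>
      B.indicator (fun y => ‖φ p.1 - φ y‖ₑ ^ 2) (p.1 + p.2) := by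
    have h : Continuous fun p : Space n × Space n => φ p.1 - φ (p.1 + p.2) := by fun_prop
    exact Measurable.ite (hBm.preimage (measurable_fst.add measurable_snd))
      (h.enorm.measurable.pow_const 2) measurable_const
  calc ∫⁻ x in B, ∫⁻ y in B, ‖φ x - φ y‖ₑ ^ 2
      = ∫⁻ x in B, ∫⁻ h, B.indicator (fun y => ‖φ x - φ y‖ₑ ^ 2) (x + h) := by
        refine lintegral_congr fun x => ?_
        rw [lintegral_add_left_eq_self (B.indicator fun y => ‖φ x - φ y‖ₑ ^ 2) x,
          lintegral_indicator hBm]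
    _ = ∫⁻ h, ∫⁻ x in B, B.indicator (fun y => ‖φ x - φ y‖ₑ ^ 2) (x + h) :=
        lintegral_lintegral_swap hm.aemeasurable
    _ ≤ ∫⁻ h, (Metric.ball (0 : Space n) (2 * r)).indicator
          (fun _ => ENNReal.ofReal (2 * r) ^ 2 * G) h := by
        refine lintegral_mono fun h => ?_
        set A := B ∩ (fun x => x + h) ⁻¹' B with hA
        have hAm : MeasurableSet A := hBm.inter (hBm.preimage (measurable_add_const h))
        have e : ∫⁻ x in B, B.indicator (fun y => ‖φ x - φ y‖ₑ ^ 2) (x + h) =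
            ∫⁻ x in A, ‖φ (x + h) - φ x‖ₑ ^ 2 := by
          rw [← lintegral_indicator hBm, ← lintegral_indicator hAm]
          refine lintegral_congr fun x => ?_
          by_cases hx : x ∈ B <;> by_cases hxh : x + h ∈ B <;>
            simp [Set.indicator, hA, hx, hxh, enorm_sub_rev]
        dsimp only
        rw [e]
        by_cases hh : h ∈ Metric.ball (0 : Space n) (2 * r)
        · rw [Set.indicator_of_mem hh]
          refine (lintegral_shift_sub_sq_le hφ hAm hΩ h ?_).trans ?_
          · intro x hx t ht
            apply hB
            have hconv : Convex ℝ B := convex_ball x₀ r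
            have := hconv hx.1 hx.2 (sub_nonneg.2 ht.2) ht.1 (by ring)
            convert this using 1
            module
          · gcongr
            rw [← ofReal_norm]
            exact ENNReal.ofReal_le_ofReal (by simpa using (mem_ball_zero_iff.1 hh).le)
        · have : A = ∅ := by
            rw [Set.eq_empty_iff_forall_notMem]
            rintro x ⟨hx, hxh⟩
            apply hh
            rw [hBdef, Metric.mem_ball] at hx
            rw [Set.mem_preimage, hBdef, Metric.mem_ball] at hxh
            rw [mem_ball_zero_iff, ← add_sub_cancel_left x h, ← dist_eq_norm]
            linarith [dist_triangle_right (x + h) x x₀]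
          simp [this]
    _ = _ := by
        rw [lintegral_indicator measurableSet_ball, setLIntegral_const]
        ring

end OscBound

/-- Compare `φ x` with `φ (x + h)` by the shift estimate, then `φ (x + h)` with `φ y` inside `B`,
where the oscillation is already controlled. -/
theorem OscBound.of_shift {n : ℕ} {Ω A B : Set (Space n)} (hA : MeasurableSet A)
    (hΩ : MeasurableSet Ω) (hBf : volume B ≠ ⊤) (hB : OscBound Ω B B)
    (hBm : MeasurableSet B) (h : Space n)
    (hAB : ∀ x ∈ A, x + h ∈ B) (hAΩ : ∀ x ∈ A, ∀ t ∈ Set.Icc (0 : ℝ) 1, x + t • h ∈ Ω) :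
    OscBound Ω A B := by
  obtain ⟨C, hC, hB⟩ := hB
  refine ⟨2 * (volume B * ‖h‖ₑ ^ 2 + C), by finiteness, fun φ hφ => ?_⟩
  have hφc := hφ.continuous
  have hm : Measurable fun x => ‖φ (x + h) - φ x‖ₑ ^ 2 := by
    have h : Continuous fun x => φ (x + h) - φ x := by fun_prop
    exact h.enorm.measurable.pow_const 2
  calc ∫⁻ x in A, ∫⁻ y in B, ‖φ x - φ y‖ₑ ^ 2
      ≤ ∫⁻ x in A, ∫⁻ y in B, 2 * (‖φ (x + h) - φ x‖ₑ ^ 2 + ‖φ (x + h) - φ y‖ₑ ^ 2) := by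
        refine lintegral_mono fun x => lintegral_mono fun y => ?_
        have := enorm_sub_sq_le (φ x) (φ (x + h)) (φ y)
        rwa [enorm_sub_rev (φ x) (φ (x + h))] at this
    _ = ∫⁻ x in A, 2 * (volume B * ‖φ (x + h) - φ x‖ₑ ^ 2 +
          ∫⁻ y in B, ‖φ (x + h) - φ y‖ₑ ^ 2) := by
        refine lintegral_congr fun x => ?_
        rw [lintegral_const_mul' _ _ (by simp), lintegral_add_left measurable_const,
          setLIntegral_const, mul_comm (volume B)]
    _ = 2 * (volume B * (∫⁻ x in A, ‖φ (x + h) - φ x‖ₑ ^ 2) +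
          ∫⁻ x in A, ∫⁻ y in B, ‖φ (x + h) - φ y‖ₑ ^ 2) := by
        rw [lintegral_const_mul' _ _ (by simp), lintegral_add_left (hm.const_mul _),
          lintegral_const_mul' _ _ hBf]
    _ ≤ 2 * (volume B * (‖h‖ₑ ^ 2 * ∫⁻ x in Ω, ‖classicalGrad φ x‖ₑ ^ 2) +
          C * ∫⁻ x in Ω, ‖classicalGrad φ x‖ₑ ^ 2) := by
        refine mul_le_mul_right (add_le_add (mul_le_mul_right
          (lintegral_shift_sub_sq_le hφ hA hΩ h hAΩ) _) (le_trans ?_ (hB φ hφ))) _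
        rw [← lintegral_indicator hA, ← lintegral_indicator hBm,
          ← lintegral_add_right_eq_self (B.indicator _) h]
        refine lintegral_mono fun x => ?_
        by_cases hx : x ∈ A
        · rw [Set.indicator_of_mem hx, Set.indicator_of_mem (hAB x hx)]
        · rw [Set.indicator_of_notMem hx]
          exact zero_le
    _ = _ := by ring

/-- Every point of the closure of a Lipschitz domain has a neighbourhood on which the oscillation
of smooth functions is controlled by the gradient. -/
theorem IsLipschitzDomain.exists_nhds_oscBound {n : ℕ} {Ω : Set (Space n)}
    (hΩ : IsLipschitzDomain Ω) {p : Space n} (hp : p ∈ closure Ω) :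
    ∃ r > 0, OscBound Ω (Metric.ball p r ∩ Ω) (Metric.ball p r ∩ Ω) := by
  obtain ⟨e, r, δ, he, hr, hδ, hδ1, hcone⟩ := hΩ.exists_cone hp
  have hΩm : MeasurableSet Ω := hΩ.isOpen.measurableSet
  set s := r / 2 with hs
  have hs0 : 0 < s := by positivity
  have hsr : s < r := by rw [hs]; linarith
  -- Points of `Ω` within `q` of `p` are within `2 * q < δ * s` of `x₀`, so the common shift `s • e`
  -- moves them all into the single ball `Metric.ball (x₀ + s • e) (δ * s)`, which lies in `Ω`.
  set q := δ * s / 3 with hq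
  have hq0 : 0 < q := by positivity
  have hqr : q ≤ r := by
    have : δ * s ≤ s := by nlinarith
    linarith
  obtain ⟨x₀, hx₀Ω, hx₀p⟩ := Metric.mem_closure_iff.1 hp q hq0
  rw [dist_comm] at hx₀p
  have hBΩ : Metric.ball (x₀ + s • e) (δ * s) ⊆ Ω :=
    hcone x₀ hx₀Ω (Metric.mem_ball.2 (hx₀p.trans_le hqr)) s hs0 hsr
  have hA : OscBound Ω (Metric.ball p q ∩ Ω) (Metric.ball (x₀ + s • e) (δ * s)) := by
    refine OscBound.of_shift (measurableSet_ball.inter hΩm) hΩm measure_ball_lt_top.ne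
      (oscBound_ball hΩm _ _ hBΩ) measurableSet_ball (s • e) ?_ ?_
    · rintro x ⟨hx, -⟩
      rw [Metric.mem_ball] at hx ⊢
      rw [dist_add_right]
      linarith [dist_triangle_right x x₀ p]
    · rintro x ⟨hx, hxΩ⟩ t ht
      rcases ht.1.eq_or_lt with rfl | ht0
      · simpa using hxΩ
      · have hts : 0 < t * s := by positivity
        refine hcone x hxΩ (Metric.ball_subset_ball hqr hx) (t * s) hts ?_ ?_
        · nlinarith [ht.2]
        · rw [mul_smul]
          exact Metric.mem_ball_self (by positivity)
  refine ⟨q, hq0, hA.trans hA.symm ?_ measure_ball_lt_top.ne ?_ ?_⟩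
  · exact ((measure_mono Set.inter_subset_left).trans_lt measure_ball_lt_top).ne
  · exact (Metric.measure_ball_pos _ _ (by positivity)).ne'
  · exact ((measure_mono Set.inter_subset_left).trans_lt measure_ball_lt_top).ne

/-- The Poincaré inequality on a Lipschitz domain, in oscillation form. -/
theorem IsLipschitzDomain.oscBound {n : ℕ} {Ω : Set (Space n)} (hΩ : IsLipschitzDomain Ω) :
    OscBound Ω Ω Ω := by
  choose! r hr hosc using fun p (hp : p ∈ closure Ω) => hΩ.exists_nhds_oscBound hp
  set W : Space n → Set (Space n) := fun p => Metric.ball p (r p) ∩ Ω with hW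
  have hWo : ∀ p, IsOpen (W p) := fun p => Metric.isOpen_ball.inter hΩ.isOpen
  have hWf : ∀ p, volume (W p) ≠ ⊤ := fun p =>
    ((measure_mono Set.inter_subset_left).trans_lt measure_ball_lt_top).ne
  -- Two overlapping neighbourhoods are linked through their intersection, which is open and
  -- nonempty and so has positive volume.
  have hlink : ∀ p ∈ closure Ω, ∀ q ∈ closure Ω, (W p ∩ W q).Nonempty →
      OscBound Ω (W p) (W q) := by
    intro p hp q hq hne
    refine ((hosc p hp).mono subset_rfl Set.inter_subset_left).trans
      ((hosc q hq).mono Set.inter_subset_right subset_rfl) (hWf p) ?_ ?_ (hWf q) (B := W p ∩ W q)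
    · exact ((measure_mono Set.inter_subset_left).trans_lt (hWf p).lt_top).ne
    · exact (((hWo p).inter (hWo q)).measure_pos volume hne).ne'
  have hself : ∀ x ∈ Ω, x ∈ W x := fun x hx =>
    ⟨Metric.mem_ball_self (hr x (subset_closure hx)), hx⟩
  have hWpos : ∀ x ∈ Ω, volume (W x) ≠ 0 := fun x hx =>
    ((hWo x).measure_pos volume ⟨x, hself x hx⟩).ne'
  have hall : ∀ x ∈ Ω, ∀ y ∈ Ω, OscBound Ω (W x) (W y) := by
    intro x hx y hy
    -- Being linked holds for nearby points and is transitive, hence holds for all pairs of points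
    -- of the connected set `Ω`.
    refine hΩ.isConnected.isPreconnected.induction₂' (fun x y => OscBound Ω (W x) (W y))
      ?_ ?_ hx hy
    · intro x hx
      filter_upwards [self_mem_nhdsWithin,
        mem_nhdsWithin_of_mem_nhds ((hWo x).mem_nhds (hself x hx))] with y hy hyx
      have := hlink x (subset_closure hx) y (subset_closure hy) ⟨y, hyx, hself y hy⟩
      exact ⟨this, this.symm⟩
    · intro x y z _ hy _ h1 h2
      exact h1.trans h2 (hWf x) (hWf y) (hWpos y hy) (hWf z)
  obtain ⟨x₀, hx₀⟩ := hΩ.isConnected.nonempty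
  have hΩf : volume Ω ≠ ⊤ := hΩ.isBounded.measure_lt_top.ne
  have hcpt : IsCompact (closure Ω) := hΩ.isBounded.isCompact_closure
  have hx₀' : OscBound Ω (closure Ω ∩ Ω) (W x₀) := by
    refine hcpt.induction_on (p := fun s => OscBound Ω (s ∩ Ω) (W x₀)) ?_ ?_ ?_ ?_
    · exact ⟨0, by simp, by simp⟩
    · exact fun s t hst ht => ht.mono (Set.inter_subset_inter_left _ hst) subset_rfl
    · intro s t hs ht
      rw [Set.union_inter_distrib_right]
      exact hs.union_left ht
    · intro p hp
      refine ⟨Metric.ball p (r p), mem_nhdsWithin_of_mem_nhds (Metric.ball_mem_nhds p (hr p hp)),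
        ?_⟩
      obtain ⟨x, hxΩ, hx⟩ := Metric.mem_closure_iff.1 hp (r p) (hr p hp)
      have hxW : x ∈ W p := ⟨by rwa [Metric.mem_ball, dist_comm], hxΩ⟩
      exact (hlink p hp x (subset_closure hxΩ) ⟨x, hxW, hself x hxΩ⟩).trans (hall x hxΩ x₀ hx₀)
        (hWf p) (hWf x) (hWpos x hxΩ) (hWf x₀)
  rw [Set.inter_eq_self_of_subset_right subset_closure] at hx₀'
  exact hx₀'.trans hx₀'.symm hΩf (hWf x₀) (hWpos x₀ hx₀) hΩf

/-! ### Graph parametrization and the surface measure -/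

/-- The point with first coordinates `y` and last coordinate `t` in the rotated coordinate
system `T`. -/
noncomputable def ofCoords {n : ℕ} (T : Space n ≃ₗᵢ[ℝ] Space n) (t : ℝ) (y : Fin n → ℝ) :
    Space n :=
  T.symm (WithLp.toLp 2 ((Fin.last n).insertNth t y : Fin (n + 1) → ℝ))

section Coords

variable {n : ℕ} (T : Space n ≃ₗᵢ[ℝ] Space n)

theorem baseCoord_ofCoords (t : ℝ) (y : Fin n → ℝ) : baseCoord T (ofCoords T t y) = y := by
  funext i
  simp only [baseCoord, ofCoords, LinearIsometryEquiv.apply_symm_apply]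
  rw [← Fin.succAbove_last_apply, Fin.insertNth_apply_succAbove]

theorem height_ofCoords (t : ℝ) (y : Fin n → ℝ) : height T (ofCoords T t y) = t := by
  simp [height, ofCoords]

theorem ofCoords_height_baseCoord (x : Space n) :
    ofCoords T (height T x) (baseCoord T x) = x := by
  rw [ofCoords, LinearIsometryEquiv.symm_apply_eq]
  ext i
  refine Fin.lastCases ?_ (fun j => ?_) i
  · simp [height]
  · rw [← Fin.succAbove_last_apply]
    simp [baseCoord]

theorem ofCoords_add (s t : ℝ) (y : Fin n → ℝ) :
    ofCoords T (s + t) y = ofCoords T s y + t • upDir T := by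
  rw [← ofCoords_height_baseCoord T (ofCoords T s y + t • upDir T), height_add_smul,
    baseCoord_add_smul, height_ofCoords, baseCoord_ofCoords]

theorem continuous_ofCoords : Continuous fun p : ℝ × (Fin n → ℝ) => ofCoords T p.1 p.2 := by
  unfold ofCoords
  refine T.symm.continuous.comp ((PiLp.continuous_toLp 2 _).comp ?_)
  exact Continuous.finInsertNth (Fin.last n) continuous_fst continuous_snd

theorem measurePreserving_ofCoords :
    MeasurePreserving (fun p : ℝ × (Fin n → ℝ) => ofCoords T p.1 p.2) := by
  have h1 := (volume_preserving_piFinSuccAbove (fun _ : Fin (n + 1) => ℝ) (Fin.last n)).symm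
  have h2 := PiLp.volume_preserving_toLp (Fin (n + 1))
  exact (T.symm.measurePreserving.comp h2).comp h1

/-- Fubini in the rotated coordinates. The shear `t ↦ ψ y + t` is a translation in each fibre, so no
regularity of `ψ` is needed. -/
theorem lintegral_ofCoords {ψ : (Fin n → ℝ) → ℝ} {F : Space n → ℝ≥0∞} (hF : Measurable F) :
    ∫⁻ y, ∫⁻ t : ℝ, F (ofCoords T (ψ y) y + t • upDir T) = ∫⁻ x, F x := by
  rw [← (measurePreserving_ofCoords T).lintegral_comp hF, Measure.volume_eq_prod,
    lintegral_prod_symm' (fun p : ℝ × (Fin n → ℝ) => F (ofCoords T p.1 p.2))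
      (hF.comp (continuous_ofCoords T).measurable)]
  refine lintegral_congr fun y => ?_
  simp only [← ofCoords_add]
  exact lintegral_add_left_eq_self (fun t => F (ofCoords T t y)) (ψ y)

theorem exists_lipschitzWith_ofCoords {ψ : (Fin n → ℝ) → ℝ} {K : NNReal}
    (hψ : LipschitzWith K ψ) : ∃ L, LipschitzWith L fun y => ofCoords T (ψ y) y := by
  have h1 : LipschitzWith (max K 1)
      fun y => ((Fin.last n).insertNth (ψ y) y : Fin (n + 1) → ℝ) := by
    refine LipschitzWith.of_dist_le_mul fun y z => ?_
    rw [dist_pi_le_iff (by positivity)]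
    have hmax : (K : ℝ) ≤ (max K 1 : NNReal) ∧ (1 : ℝ) ≤ (max K 1 : NNReal) :=
      ⟨NNReal.coe_le_coe.2 (le_max_left _ _), by exact_mod_cast le_max_right K 1⟩
    intro i
    refine Fin.lastCases ?_ (fun j => ?_) i
    · simp only [Fin.insertNth_apply_same]
      exact (hψ.dist_le_mul y z).trans (mul_le_mul_of_nonneg_right hmax.1 dist_nonneg)
    · rw [← Fin.succAbove_last_apply]
      simp only [Fin.insertNth_apply_succAbove]
      exact (dist_le_pi_dist y z j).trans (le_mul_of_one_le_left dist_nonneg hmax.2)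
  exact ⟨_, T.symm.lipschitz.comp ((PiLp.lipschitzWith_toLp 2 _).comp h1)⟩

end Coords

/-- A map with Lipschitz constant `L` enlarges the `n`-dimensional Hausdorff measure by at most `L ^
n`, and for the sup metric on `Fin n → ℝ` that measure is Lebesgue measure. The scalar factor is the
Euclidean normalization. -/
theorem exists_euclideanHausdorffMeasure_image_le {n : ℕ} {g : (Fin n → ℝ) → Space n}
    {L : NNReal} (hg : LipschitzWith L g) :
    ∃ c : ℝ≥0∞, c ≠ ⊤ ∧ ∀ S : Set (Fin n → ℝ),
      Measure.euclideanHausdorffMeasure n (g '' S) ≤ c * volume S := by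
  refine ⟨(Measure.addHaarScalarFactor (volume : Measure (EuclideanSpace ℝ (Fin n)))
    (Measure.hausdorffMeasure n) : ℝ≥0∞) * (L : ℝ≥0∞) ^ (n : ℝ), ?_, fun S => ?_⟩
  · exact ENNReal.mul_ne_top (by simp) (ENNReal.rpow_ne_top_of_nonneg (by positivity) (by simp))
  · rw [Measure.euclideanHausdorffMeasure_def, Measure.smul_apply, ENNReal.smul_def, smul_eq_mul,
      mul_assoc]
    refine mul_le_mul_right ((hg.hausdorffMeasure_image_le (by positivity) S).trans ?_) _
    rw [← hausdorffMeasure_pi_real, Fintype.card_fin]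

/-- Near a boundary point, the boundary of a Lipschitz domain is a Lipschitz graph, the surface
measure is dominated by the Lebesgue measure of the parameter domain, and the segments of a fixed
length above the graph stay in the domain. -/
theorem IsLipschitzDomain.exists_graph {n : ℕ} {Ω : Set (Space n)} (hΩ : IsLipschitzDomain Ω)
    {p : Space n} (hp : p ∈ frontier Ω) :
    ∃ (r : ℝ) (e : Space n) (g : (Fin n → ℝ) → Space n) (c : ℝ≥0∞),
      0 < r ∧ ‖e‖ = 1 ∧ Continuous g ∧ c ≠ ⊤ ∧ volume (g ⁻¹' Metric.ball p r) ≠ ⊤ ∧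
      (surfaceMeasure Ω).restrict (Metric.ball p r) ≤
        c • (volume.restrict (g ⁻¹' Metric.ball p r)).map g ∧
      (∀ y ∈ g ⁻¹' Metric.ball p r, ∀ t ∈ Set.Ioo 0 r, g y + t • e ∈ Ω) ∧
      ∀ F : Space n → ℝ≥0∞, Measurable F → ∫⁻ y, ∫⁻ t : ℝ, F (g y + t • e) = ∫⁻ x, F x := by
  obtain ⟨T, ψ, K, ρ, hψ, hρ, hch⟩ := hΩ.exists_chart hp
  obtain ⟨L, hL⟩ := exists_lipschitzWith_ofCoords T hψ
  obtain ⟨c, hc, hcS⟩ := exists_euclideanHausdorffMeasure_image_le hL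
  set g : (Fin n → ℝ) → Space n := fun y => ofCoords T (ψ y) y with hg
  have hbase : ∀ y, baseCoord T (g y) = y := fun y => baseCoord_ofCoords T _ y
  have hgraph : ∀ x ∈ frontier Ω, x ∈ Metric.ball p ρ → g (baseCoord T x) = x := by
    intro x hx hxp
    suffices h : ψ (baseCoord T x) = height T x by
      rw [hg]; dsimp only; rw [h, ofCoords_height_baseCoord]
    have hxΩ : x ∉ Ω := by
      rw [frontier, hΩ.isOpen.interior_eq] at hx
      exact hx.2
    refine le_antisymm ?_ (not_lt.1 fun h => hxΩ ((hch x hxp).2 h))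
    by_contra! hlt
    -- A point strictly below the graph has a whole neighbourhood outside `Ω`, so it is not in the
    -- closure.
    have hnhds : ∀ᶠ y in 𝓝 x, y ∉ Ω := by
      have h1 : ∀ᶠ y in 𝓝 x, height T y < ψ (baseCoord T y) :=
        (continuous_height T).continuousAt.eventually_lt
          (hψ.continuous.comp (continuous_baseCoord T)).continuousAt hlt
      filter_upwards [h1, Metric.isOpen_ball.mem_nhds hxp] with y hy hyp hyΩ
      exact absurd ((hch y hyp).1 hyΩ) (not_lt.2 hy.le)
    exact (mem_closure_iff_frequently.1 hx.1) hnhds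
  -- Half of the chart radius is left for the vertical segments, so that they do not leave the ball
  -- of radius `ρ`.
  refine ⟨ρ / 2, upDir T, g, c, by positivity, norm_upDir T, hL.continuous, hc, ?_, ?_, ?_, ?_⟩
  · refine ((measure_mono fun y hy => ?_).trans_lt
      (measure_ball_lt_top (x := baseCoord T p) (r := ρ / 2))).ne
    rw [Metric.mem_ball, ← hbase y]
    exact (dist_baseCoord_le T _ _).trans_lt hy
  · refine Measure.le_iff.2 fun S hS => ?_
    have hN : MeasurableSet (Metric.ball p (ρ / 2)) := measurableSet_ball
    rw [Measure.restrict_apply hS, surfaceMeasure, Measure.restrict_apply (hS.inter hN),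
      Measure.smul_apply, Measure.map_apply hL.continuous.measurable hS,
      Measure.restrict_apply (hL.continuous.measurable hS), smul_eq_mul]
    refine le_trans (measure_mono ?_) (hcS _)
    rintro x ⟨⟨hxS, hxN⟩, hx⟩
    have := hgraph x hx (Metric.ball_subset_ball (by linarith) hxN)
    refine ⟨baseCoord T x, ⟨?_, ?_⟩, this⟩
    · rwa [Set.mem_preimage, this]
    · rwa [Set.mem_preimage, this]
  · intro y hy t ht
    rw [Set.mem_preimage, Metric.mem_ball] at hy
    have hmem : g y + t • upDir T ∈ Metric.ball p ρ := by
      rw [Metric.mem_ball]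
      have : dist (g y + t • upDir T) (g y) = t := by
        rw [dist_eq_norm, add_sub_cancel_left, norm_smul, norm_upDir, mul_one,
          Real.norm_of_nonneg ht.1.le]
      linarith [dist_triangle (g y + t • upDir T) (g y) p, ht.2]
    rw [hch _ hmem, baseCoord_add_smul, height_add_smul, hbase]
    have : height T (g y) = ψ y := height_ofCoords T _ y
    linarith [ht.1]
  · exact fun F hF => lintegral_ofCoords T hF

theorem IsLipschitzDomain.isFiniteMeasure_surfaceMeasure {n : ℕ} {Ω : Set (Space n)}
    (hΩ : IsLipschitzDomain Ω) : IsFiniteMeasure (surfaceMeasure Ω) := by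
  have hcpt : IsCompact (frontier Ω) := hΩ.isBounded.isCompact_closure.of_isClosed_subset
    isClosed_frontier frontier_subset_closure
  have h : surfaceMeasure Ω (frontier Ω) < ⊤ := by
    refine hcpt.measure_lt_top_of_nhdsWithin fun p hp => ?_
    obtain ⟨r, e, g, c, hr, -, hg, hc, hvol, hle, -⟩ := hΩ.exists_graph hp
    refine ⟨Metric.ball p r, mem_nhdsWithin_of_mem_nhds (Metric.ball_mem_nhds p hr), ?_⟩
    rw [← Measure.restrict_apply_univ]
    refine (hle Set.univ).trans_lt ?_
    rw [Measure.smul_apply, Measure.map_apply hg.measurable MeasurableSet.univ, Set.preimage_univ,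
      Measure.restrict_apply_univ, smul_eq_mul]
    exact ENNReal.mul_lt_top hc.lt_top hvol.lt_top
  refine ⟨?_⟩
  have : surfaceMeasure Ω Set.univ = surfaceMeasure Ω (frontier Ω) := by
    simp [surfaceMeasure]
  rwa [this]

/-! ### The multiplicative trace inequality for smooth functions -/

/-- The square `φ ^ 2`, unlike `|φ|`, stays smooth and has modulus `|φ|²`. Its derivative yields the
product `|φ| |∇φ|` that makes the trace inequality multiplicative. -/
theorem enorm_fderiv_sq_apply_le {n : ℕ} {φ : Space n → ℂ} (hφ : ContDiff ℝ ∞ φ)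
    (x e : Space n) :
    ‖fderiv ℝ (fun x => φ x ^ 2) x e‖ₑ ≤ ‖e‖ₑ * (2 * (‖φ x‖ₑ * ‖classicalGrad φ x‖ₑ)) := by
  have hd : HasFDerivAt φ (fderiv ℝ φ x) x :=
    (hφ.differentiable (by simp)).differentiableAt.hasFDerivAt
  have : fderiv ℝ (fun x => φ x ^ 2) x e = 2 * (φ x * fderiv ℝ φ x e) := by
    rw [(hd.pow 2).fderiv]
    simp [mul_assoc]
  rw [this, enorm_mul, enorm_mul]
  have h2 : ‖(2 : ℂ)‖ₑ = 2 := by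
    rw [← ofReal_norm]; simp
  rw [h2]
  calc 2 * (‖φ x‖ₑ * ‖fderiv ℝ φ x e‖ₑ)
      ≤ 2 * (‖φ x‖ₑ * (‖e‖ₑ * ‖classicalGrad φ x‖ₑ)) := by
        gcongr
        exact enorm_fderiv_apply_le φ x e
    _ = _ := by ring

/-- A one-dimensional trace inequality along a segment. -/
theorem enorm_sq_le_lintegral_segment {n : ℕ} {φ : Space n → ℂ} (hφ : ContDiff ℝ ∞ φ)
    (x e : Space n) (he : ‖e‖ = 1) {r : ℝ} (hr : 0 < r) :
    ‖φ x‖ₑ ^ 2 ≤ ∫⁻ t in Set.Ioo 0 r, ((ENNReal.ofReal r)⁻¹ * ‖φ (x + t • e)‖ₑ ^ 2 +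
      2 * (‖φ (x + t • e)‖ₑ * ‖classicalGrad φ (x + t • e)‖ₑ)) := by
  have he' : ‖e‖ₑ = 1 := by rw [← ofReal_norm, he, ENNReal.ofReal_one]
  have hr0 : ENNReal.ofReal r ≠ 0 := by simpa using hr
  have hrt : ENNReal.ofReal r ≠ ⊤ := ENNReal.ofReal_ne_top
  have hsq : ContDiff ℝ 1 fun x => φ x ^ 2 := (hφ.of_le (by simp)).pow 2
  set I := ∫⁻ t in Set.Ioo 0 r, 2 * (‖φ (x + t • e)‖ₑ * ‖classicalGrad φ (x + t • e)‖ₑ) with hI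
  -- The error `I` does not depend on `t`, so averaging over the segment only replaces the value at
  -- height `t` by its mean.
  have hpt : ∀ t ∈ Set.Ioo 0 r, ‖φ x‖ₑ ^ 2 ≤ ‖φ (x + t • e)‖ₑ ^ 2 + I := by
    intro t ht
    have h1 : ‖φ (x + t • e) ^ 2 - φ x ^ 2‖ₑ ≤ I := by
      refine (enorm_add_smul_sub_le_lintegral hsq x e ht.1.le).trans ?_
      refine (lintegral_mono_set fun s hs => (⟨hs.1, hs.2.trans_lt ht.2⟩ : s ∈ Set.Ioo 0 r)).trans
        (lintegral_mono fun s => ?_)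
      simpa [he'] using enorm_fderiv_sq_apply_le hφ (x + s • e) e
    rw [← enorm_pow, ← enorm_pow]
    calc ‖φ x ^ 2‖ₑ = ‖φ (x + t • e) ^ 2 - (φ (x + t • e) ^ 2 - φ x ^ 2)‖ₑ := by
          rw [sub_sub_cancel]
      _ ≤ ‖φ (x + t • e) ^ 2‖ₑ + ‖φ (x + t • e) ^ 2 - φ x ^ 2‖ₑ := enorm_sub_le
      _ ≤ _ := by gcongr
  have hc : Continuous fun t : ℝ => φ (x + t • e) := hφ.continuous.comp (by fun_prop)
  have hm : Measurable fun t : ℝ => ‖φ (x + t • e)‖ₑ ^ 2 := hc.enorm.measurable.pow_const 2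
  have havg : ENNReal.ofReal r * ‖φ x‖ₑ ^ 2 ≤
      (∫⁻ t in Set.Ioo 0 r, ‖φ (x + t • e)‖ₑ ^ 2) + ENNReal.ofReal r * I := by
    have := setLIntegral_mono' (μ := volume) measurableSet_Ioo hpt
    rw [setLIntegral_const, lintegral_add_right _ measurable_const, setLIntegral_const,
      Real.volume_Ioo, sub_zero] at this
    rwa [mul_comm, mul_comm _ I]
  rw [lintegral_add_left (hm.const_mul _), lintegral_const_mul _ hm, ← hI]
  calc ‖φ x‖ₑ ^ 2 = (ENNReal.ofReal r)⁻¹ * (ENNReal.ofReal r * ‖φ x‖ₑ ^ 2) := by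
        rw [← mul_assoc, ENNReal.inv_mul_cancel hr0 hrt, one_mul]
    _ ≤ (ENNReal.ofReal r)⁻¹ *
        ((∫⁻ t in Set.Ioo 0 r, ‖φ (x + t • e)‖ₑ ^ 2) + ENNReal.ofReal r * I) :=
        mul_le_mul_right havg _
    _ = _ := by
        rw [mul_add, ← mul_assoc _ _ I, ENNReal.inv_mul_cancel hr0 hrt, one_mul]

/-- The multiplicative trace inequality for smooth functions. -/
theorem IsLipschitzDomain.exists_smooth_trace_le {n : ℕ} {Ω : Set (Space n)}
    (hΩ : IsLipschitzDomain Ω) :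
    ∃ C : ℝ≥0∞, C ≠ ⊤ ∧ ∀ φ : Space n → ℂ, ContDiff ℝ ∞ φ →
      ∫⁻ x, ‖φ x‖ₑ ^ 2 ∂(surfaceMeasure Ω) ≤
        C * ((∫⁻ x in Ω, ‖φ x‖ₑ ^ 2) + ∫⁻ x in Ω, ‖φ x‖ₑ * ‖classicalGrad φ x‖ₑ) := by
  have hcpt : IsCompact (frontier Ω) := hΩ.isBounded.isCompact_closure.of_isClosed_subset
    isClosed_frontier frontier_subset_closure
  have hΩm : MeasurableSet Ω := hΩ.isOpen.measurableSet
  suffices h : ∃ C : ℝ≥0∞, C ≠ ⊤ ∧ ∀ φ : Space n → ℂ, ContDiff ℝ ∞ φ →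
      ∫⁻ x in frontier Ω, ‖φ x‖ₑ ^ 2 ∂(surfaceMeasure Ω) ≤
        C * ((∫⁻ x in Ω, ‖φ x‖ₑ ^ 2) + ∫⁻ x in Ω, ‖φ x‖ₑ * ‖classicalGrad φ x‖ₑ) by
    simpa [surfaceMeasure, Measure.restrict_restrict isClosed_frontier.measurableSet] using h
  refine hcpt.induction_on (p := fun s => ∃ C : ℝ≥0∞, C ≠ ⊤ ∧ ∀ φ : Space n → ℂ, ContDiff ℝ ∞ φ →
      ∫⁻ x in s, ‖φ x‖ₑ ^ 2 ∂(surfaceMeasure Ω) ≤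
        C * ((∫⁻ x in Ω, ‖φ x‖ₑ ^ 2) + ∫⁻ x in Ω, ‖φ x‖ₑ * ‖classicalGrad φ x‖ₑ))
    ⟨0, by simp, by simp⟩ ?_ ?_ ?_
  · rintro s t hst ⟨C, hC, h⟩
    exact ⟨C, hC, fun φ hφ => (lintegral_mono_set hst).trans (h φ hφ)⟩
  · rintro s t ⟨C₁, hC₁, h₁⟩ ⟨C₂, hC₂, h₂⟩
    refine ⟨C₁ + C₂, ENNReal.add_ne_top.2 ⟨hC₁, hC₂⟩, fun φ hφ => ?_⟩
    rw [add_mul]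
    exact (lintegral_union_le _ _ _).trans (add_le_add (h₁ φ hφ) (h₂ φ hφ))
  · intro p hp
    obtain ⟨r, e, g, c, hr, he, hg, hc, -, hle, hseg, hint⟩ := hΩ.exists_graph hp
    refine ⟨Metric.ball p r, mem_nhdsWithin_of_mem_nhds (Metric.ball_mem_nhds p hr),
      c * ((ENNReal.ofReal r)⁻¹ + 2), ?_, fun φ hφ => ?_⟩
    · exact ENNReal.mul_ne_top hc (ENNReal.add_ne_top.2 ⟨by simpa using hr, by simp⟩)
    have hφm : Measurable fun x => ‖φ x‖ₑ ^ 2 := hφ.continuous.enorm.measurable.pow_const 2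
    have hφgm : Measurable fun x => ‖φ x‖ₑ * ‖classicalGrad φ x‖ₑ :=
      hφ.continuous.enorm.measurable.mul (continuous_classicalGrad hφ).enorm.measurable
    set H : Space n → ℝ≥0∞ := fun x => (ENNReal.ofReal r)⁻¹ * ‖φ x‖ₑ ^ 2 +
      2 * (‖φ x‖ₑ * ‖classicalGrad φ x‖ₑ) with hH
    have hHm : Measurable H := (hφm.const_mul _).add (hφgm.const_mul _)
    set Q := g ⁻¹' Metric.ball p r with hQ
    have hQm : MeasurableSet Q := (Metric.isOpen_ball.preimage hg).measurableSet
    calc ∫⁻ x in Metric.ball p r, ‖φ x‖ₑ ^ 2 ∂(surfaceMeasure Ω)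
        ≤ ∫⁻ x, ‖φ x‖ₑ ^ 2 ∂(c • (volume.restrict Q).map g) := lintegral_mono' hle le_rfl
      _ = c * ∫⁻ y in Q, ‖φ (g y)‖ₑ ^ 2 := by
          rw [lintegral_smul_measure, lintegral_map hφm hg.measurable, smul_eq_mul]
      _ ≤ c * ∫⁻ x in Ω, H x := by
          refine mul_le_mul_right ?_ c
          -- Extended by zero off `Ω`, the integral of `H` becomes an iterated integral along all
          -- vertical lines. Those over `Q` contain the segments in question, and the rest is
          -- nonnegative.
          rw [← lintegral_indicator hΩm, ← hint _ (hHm.indicator hΩm), ← lintegral_indicator hQm]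
          refine lintegral_mono fun y => ?_
          by_cases hy : y ∈ Q
          · rw [Set.indicator_of_mem hy]
            refine (enorm_sq_le_lintegral_segment hφ (g y) e he hr).trans ?_
            rw [← lintegral_indicator measurableSet_Ioo]
            refine lintegral_mono fun t => ?_
            by_cases ht : t ∈ Set.Ioo 0 r
            · rw [Set.indicator_of_mem ht, Set.indicator_of_mem (hseg y hy t ht)]
            · rw [Set.indicator_of_notMem ht]
              exact zero_le
          · rw [Set.indicator_of_notMem hy]
            exact zero_le
      _ = c * ((ENNReal.ofReal r)⁻¹ * (∫⁻ x in Ω, ‖φ x‖ₑ ^ 2) +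
            2 * ∫⁻ x in Ω, ‖φ x‖ₑ * ‖classicalGrad φ x‖ₑ) := by
          rw [hH, lintegral_add_left (hφm.const_mul _), lintegral_const_mul _ hφm,
            lintegral_const_mul _ hφgm]
      _ ≤ _ := by
          rw [mul_assoc]
          refine mul_le_mul_right ?_ c
          rw [mul_add]
          gcongr
          · exact le_self_add
          · exact le_add_self

/-! ### Mollification in `L²` -/

section Mollify

variable {n : ℕ} {F : Type*} [NormedAddCommGroup F]

theorem tendsto_eLpNorm_translate {w : Space n → F} (hw : MemLp w 2 volume) :
    Tendsto (fun y => eLpNorm (fun x => w (x - y) - w x) 2 volume) (𝓝 0) (𝓝 0) := by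
  have : Fact ((2 : ℝ≥0∞) ≠ ⊤) := ⟨by simp⟩
  let g : C(Space n, C(Space n, Space n)) :=
    (ContinuousMap.mk (fun p : Space n × Space n => p.2 - p.1) (by fun_prop)).curry
  have hgm : ∀ y, MeasurePreserving (g y) (volume : Measure (Space n)) volume := fun y =>
    measurePreserving_sub_right volume y
  have hcont := Continuous.compMeasurePreservingLp (f := fun _ : Space n => hw.toLp w)
    continuous_const g.continuous hgm (by simp)
  have h1 : ∀ y, eLpNorm (fun x => w (x - y) - w x) 2 volume =
      edist (Lp.compMeasurePreserving (g y) (hgm y) (hw.toLp w)) (hw.toLp w) := by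
    intro y
    rw [Lp.toLp_compMeasurePreserving, Lp.edist_toLp_toLp]
    rfl
  have h0 : Lp.compMeasurePreserving (g 0) (hgm 0) (hw.toLp w) = hw.toLp w := by
    rw [← edist_eq_zero, ← h1]
    simp
  have := (hcont.edist (continuous_const (y := hw.toLp w))).tendsto (0 : Space n)
  simpa only [← h1, h0, edist_self] using this

theorem eLpNorm_two_sq {α : Type*} [MeasurableSpace α] {μ : Measure α} (f : α → F) :
    eLpNorm f 2 μ ^ 2 = ∫⁻ x, ‖f x‖ₑ ^ 2 ∂μ := by
  rw [eLpNorm_eq_lintegral_rpow_enorm_toReal (by simp) (by simp), ← ENNReal.rpow_natCast,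
    ← ENNReal.rpow_mul]
  norm_num

variable [NormedSpace ℝ F]

open ContinuousLinearMap in
-- Jensen's inequality for the probability density `κ`, obtained from Cauchy–Schwarz by splitting `κ
-- = √κ * √κ`.
theorem enorm_convolution_sub_sq_le [CompleteSpace F] {w : Space n → F}
    (hw : LocallyIntegrable w volume)
    {κ : Space n → ℝ} (hκ : Continuous κ) (hκc : HasCompactSupport κ) (hκ0 : ∀ y, 0 ≤ κ y)
    (hκ1 : ∫ y, κ y = 1) (x : Space n) (hm : AEMeasurable (fun y => ‖w (x - y) - w x‖ₑ)) :
    ‖(convolution κ w (lsmul ℝ ℝ) volume) x - w x‖ₑ ^ 2 ≤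
      ∫⁻ y, ENNReal.ofReal (κ y) * ‖w (x - y) - w x‖ₑ ^ 2 := by
  have hκi : Integrable κ := hκ.integrable_of_hasCompactSupport hκc
  have hex : Integrable fun y => κ y • w (x - y) :=
    (hκc.convolutionExists_left (lsmul ℝ ℝ) hκ hw) x
  have h1 : (convolution κ w (lsmul ℝ ℝ) volume) x - w x = ∫ y, κ y • (w (x - y) - w x) := by
    simp only [smul_sub]
    rw [integral_sub hex (hκi.smul_const _), integral_smul_const, hκ1, one_smul]
    rfl
  have hmκ : Measurable fun y => ENNReal.ofReal (κ y) := hκ.measurable.ennreal_ofReal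
  have hun : ∫⁻ y, ENNReal.ofReal (κ y) = 1 := by
    rw [← ofReal_integral_eq_lintegral_ofReal hκi (Eventually.of_forall hκ0), hκ1,
      ENNReal.ofReal_one]
  have hsqrt : ∀ y, ENNReal.ofReal (√(κ y)) ^ 2 = ENNReal.ofReal (κ y) := fun y => by
    rw [← ENNReal.ofReal_pow (Real.sqrt_nonneg _), Real.sq_sqrt (hκ0 y)]
  have hsm : AEMeasurable fun y => ENNReal.ofReal (√(κ y)) :=
    hκ.measurable.sqrt.ennreal_ofReal.aemeasurable
  calc ‖(convolution κ w (lsmul ℝ ℝ) volume) x - w x‖ₑ ^ 2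
      ≤ (∫⁻ y, ENNReal.ofReal (√(κ y)) * (ENNReal.ofReal (√(κ y)) * ‖w (x - y) - w x‖ₑ)) ^ 2 := by
        rw [h1]
        refine pow_le_pow_left₀ zero_le ((enorm_integral_le_lintegral_enorm _).trans
          (le_of_eq (lintegral_congr fun y => ?_))) 2
        rw [← mul_assoc, ← sq, hsqrt, enorm_smul, Real.enorm_of_nonneg (hκ0 y)]
    _ ≤ _ := sq_lintegral_mul_le hsm (hsm.mul hm)
    _ = _ := by simp only [mul_pow, hsqrt, hun, one_mul]

open ContinuousLinearMap in
/-- Convolutions with an approximate identity converge in `L²`. -/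
theorem tendsto_eLpNorm_convolution_sub [CompleteSpace F] {w : Space n → F}
    (hw : MemLp w 2 volume) (hws : StronglyMeasurable w) {κ : ℕ → Space n → ℝ}
    (hκ : ∀ k, Continuous (κ k)) (hκc : ∀ k, HasCompactSupport (κ k)) (hκ0 : ∀ k y, 0 ≤ κ k y)
    (hκ1 : ∀ k, ∫ y, κ k y = 1)
    (hsupp : ∀ ε > 0, ∀ᶠ k in atTop, ∀ y, κ k y ≠ 0 → ‖y‖ < ε) :
    Tendsto (fun k => eLpNorm (fun x => (convolution (κ k) w (lsmul ℝ ℝ) volume) x - w x) 2 volume)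
      atTop (𝓝 0) := by
  rw [ENNReal.tendsto_nhds_zero]
  intro ε hε
  obtain ⟨δ, hδ, hδε⟩ := Metric.eventually_nhds_iff.1
    (ENNReal.tendsto_nhds_zero.1 (tendsto_eLpNorm_translate hw) ε hε)
  filter_upwards [hsupp δ hδ] with k hk
  refine (ENNReal.pow_le_pow_left_iff two_ne_zero).1 ?_
  have hli : LocallyIntegrable w volume := hw.locallyIntegrable (by norm_num)
  have hm2 : StronglyMeasurable fun p : Space n × Space n => w (p.1 - p.2) - w p.1 :=
    (hws.comp_measurable (measurable_fst.sub measurable_snd)).sub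
      (hws.comp_measurable measurable_fst)
  have hmx : ∀ x, AEMeasurable (fun y => ‖w (x - y) - w x‖ₑ) := fun x =>
    ((hws.comp_measurable (measurable_const.sub measurable_id)).sub
      stronglyMeasurable_const).enorm.aemeasurable
  have hmκ : Measurable fun y => ENNReal.ofReal (κ k y) := (hκ k).measurable.ennreal_ofReal
  have hun : ∫⁻ y, ENNReal.ofReal (κ k y) = 1 := by
    rw [← ofReal_integral_eq_lintegral_ofReal ((hκ k).integrable_of_hasCompactSupport (hκc k))
      (Eventually.of_forall (hκ0 k)), hκ1, ENNReal.ofReal_one]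
  calc eLpNorm (fun x => (convolution (κ k) w (lsmul ℝ ℝ) volume) x - w x) 2 volume ^ 2
      = ∫⁻ x, ‖(convolution (κ k) w (lsmul ℝ ℝ) volume) x - w x‖ₑ ^ 2 := eLpNorm_two_sq _
    _ ≤ ∫⁻ x, ∫⁻ y, ENNReal.ofReal (κ k y) * ‖w (x - y) - w x‖ₑ ^ 2 :=
        lintegral_mono fun x =>
          enorm_convolution_sub_sq_le hli (hκ k) (hκc k) (hκ0 k) (hκ1 k) x (hmx x)
    _ = ∫⁻ y, ∫⁻ x, ENNReal.ofReal (κ k y) * ‖w (x - y) - w x‖ₑ ^ 2 := by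
        refine lintegral_lintegral_swap (Measurable.aemeasurable ?_)
        exact (hmκ.comp measurable_snd).mul (hm2.enorm.pow_const 2)
    _ = ∫⁻ y, ENNReal.ofReal (κ k y) * eLpNorm (fun x => w (x - y) - w x) 2 volume ^ 2 := by
        refine lintegral_congr fun y => ?_
        rw [lintegral_const_mul' _ _ ENNReal.ofReal_ne_top, eLpNorm_two_sq]
    _ ≤ ∫⁻ y, ENNReal.ofReal (κ k y) * ε ^ 2 := by
        refine lintegral_mono fun y => ?_
        by_cases hy : κ k y = 0
        · simp [hy]
        · have := hδε (y := y) (by simpa using hk y hy)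
          dsimp only
          gcongr
    _ = ε ^ 2 := by
        rw [lintegral_mul_const _ hmκ, hun, one_mul]

end Mollify

/-! ### Density of smooth functions in the Sobolev space -/

/-- The weak gradient of the product of `u` with a smooth function `θ`. -/
noncomputable def cutoffGrad {n : ℕ} {Ω : Set (Space n)} (θ : Space n → ℝ) (u : H1 Ω)
    (z : Space n) : GradSpace n :=
  fn u z • classicalGrad (fun x => (θ x : ℂ)) z + θ z • grad u z

theorem classicalGrad_ofReal_apply {n : ℕ} {θ : Space n → ℝ} (hθ : ContDiff ℝ ∞ θ) (z : Space n)
    (i : Fin (n + 1)) :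
    classicalGrad (fun x => (θ x : ℂ)) z i = (fderiv ℝ θ z (EuclideanSpace.single i 1) : ℝ) := by
  have hd : HasFDerivAt θ (fderiv ℝ θ z) z :=
    (hθ.differentiable (by simp)).differentiableAt.hasFDerivAt
  have := (Complex.ofRealCLM.hasFDerivAt.comp z hd).fderiv
  change fderiv ℝ (Complex.ofRealCLM ∘ θ) z _ = _
  rw [this]
  simp

section Cutoff

variable {n : ℕ} {Ω : Set (Space n)} {θ : Space n → ℝ}

theorem contDiff_ofReal_comp (hθ : ContDiff ℝ ∞ θ) : ContDiff ℝ ∞ fun x => (θ x : ℂ) :=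
  Complex.ofRealCLM.contDiff.comp hθ

theorem cutoffGrad_apply (hθ : ContDiff ℝ ∞ θ) (u : H1 Ω) (z : Space n) (i : Fin (n + 1)) :
    cutoffGrad θ u z i =
      fderiv ℝ θ z (EuclideanSpace.single i 1) • fn u z + θ z • grad u z i := by
  have : cutoffGrad θ u z i =
      fn u z * classicalGrad (fun x => (θ x : ℂ)) z i + θ z • grad u z i := rfl
  rw [this, classicalGrad_ofReal_apply hθ]
  simp only [Complex.real_smul]
  ring

theorem stronglyMeasurable_cutoffGrad (hθ : ContDiff ℝ ∞ θ) (u : H1 Ω) :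
    StronglyMeasurable (cutoffGrad θ u) := by
  refine ((Lp.stronglyMeasurable (fn u)).smul
    (continuous_classicalGrad (contDiff_ofReal_comp hθ)).stronglyMeasurable).add
    (hθ.continuous.stronglyMeasurable.smul (Lp.stronglyMeasurable (grad u)))

theorem memLp_cutoff (hθ : ContDiff ℝ ∞ θ) (hθc : HasCompactSupport θ) (u : H1 Ω) :
    MemLp (fun z => θ z • fn u z) 2 (volume.restrict Ω) := by
  have h1 : MemLp θ ∞ (volume.restrict Ω) :=
    (hθ.continuous.memLp_top_of_hasCompactSupport hθc volume).restrict Ω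
  exact (Lp.memLp (fn u)).smul h1

theorem hasCompactSupport_classicalGrad {φ : Space n → ℂ} (hφ : HasCompactSupport φ) :
    HasCompactSupport (classicalGrad φ) := by
  refine (hφ.fderiv ℝ).mono fun x hx => ?_
  rw [Function.mem_support] at hx ⊢
  intro h
  apply hx
  ext i
  simp [classicalGrad, h]

theorem memLp_cutoffGrad (hθ : ContDiff ℝ ∞ θ) (hθc : HasCompactSupport θ) (u : H1 Ω) :
    MemLp (cutoffGrad θ u) 2 (volume.restrict Ω) := by
  have h1 : MemLp θ ∞ (volume.restrict Ω) :=
    (hθ.continuous.memLp_top_of_hasCompactSupport hθc volume).restrict Ω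
  have hc : HasCompactSupport fun x => (θ x : ℂ) :=
    hθc.comp_left (g := fun t : ℝ => (t : ℂ)) Complex.ofReal_zero
  have h2 : MemLp (classicalGrad fun x => (θ x : ℂ)) ∞ (volume.restrict Ω) :=
    ((continuous_classicalGrad (contDiff_ofReal_comp hθ)).memLp_top_of_hasCompactSupport
      (hasCompactSupport_classicalGrad hc) volume).restrict Ω
  exact (h2.smul (Lp.memLp (fn u))).add ((Lp.memLp (grad u)).smul h1)

open ContinuousLinearMap in
-- The zero extension of `θ u` need not be weakly differentiable across the boundary. At a point `x`
-- where `z ↦ κ (x - z) * θ z` is supported in `Ω`, however, that function is an admissible test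
-- function for `u`, and no boundary term arises.
theorem classicalGrad_convolution_cutoff (hΩ : MeasurableSet Ω) (hθ : ContDiff ℝ ∞ θ)
    (hθc : HasCompactSupport θ) (u : H1 Ω) {κ : Space n → ℝ} (hκ : ContDiff ℝ ∞ κ)
    (hκc : HasCompactSupport κ) (x : Space n)
    (hx : tsupport (fun z => κ (x - z) * θ z) ⊆ Ω) :
    classicalGrad (convolution κ (Ω.indicator fun z => θ z • fn u z) (lsmul ℝ ℝ) volume) x =
      convolution κ (Ω.indicator (cutoffGrad θ u)) (lsmul ℝ ℝ) volume x := by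
  set w := Ω.indicator fun z => θ z • fn u z with hw
  set W := Ω.indicator (cutoffGrad θ u) with hW
  have hwL : LocallyIntegrable w volume :=
    ((memLp_indicator_iff_restrict hΩ).2 (memLp_cutoff hθ hθc u)).locallyIntegrable (by norm_num)
  have hWL : LocallyIntegrable W volume :=
    ((memLp_indicator_iff_restrict hΩ).2 (memLp_cutoffGrad hθ hθc u)).locallyIntegrable
      (by norm_num)
  have hdκ : Continuous (fderiv ℝ κ) := hκ.continuous_fderiv (by simp)
  ext i
  set e : Space n := EuclideanSpace.single i 1 with he
  have hdκe : Continuous fun z => fderiv ℝ κ (x - z) e :=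
    (hdκ.comp (by fun_prop)).clm_apply continuous_const
  have hdθe : Continuous fun z => fderiv ℝ θ z e :=
    (hθ.continuous_fderiv (by simp)).clm_apply continuous_const
  have hκx : ContDiff ℝ ∞ fun z => κ (x - z) := hκ.comp (contDiff_const.sub contDiff_id)
  have hL : classicalGrad (convolution κ w (lsmul ℝ ℝ) volume) x i =
      ∫ z in Ω, (fderiv ℝ κ (x - z) e * θ z) • fn u z := by
    have h1 : classicalGrad (convolution κ w (lsmul ℝ ℝ) volume) x i =
        (convolution (fderiv ℝ κ) w ((lsmul ℝ ℝ : ℝ →L[ℝ] ℂ →L[ℝ] ℂ).precompL (Space n)) volume x)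
          e := by
      rw [← (hκc.hasFDerivAt_convolution_left (lsmul ℝ ℝ) (hκ.of_le (by simp)) hwL x).fderiv]
      rfl
    have hex := (((hκc.fderiv ℝ).convolutionExists_left
      ((lsmul ℝ ℝ : ℝ →L[ℝ] ℂ →L[ℝ] ℂ).precompL (Space n)) hdκ hwL) x).integrable_swap
    rw [h1, convolution_eq_swap, ContinuousLinearMap.integral_apply hex, ← integral_indicator hΩ]
    refine integral_congr_ae (Eventually.of_forall fun z => ?_)
    by_cases hz : z ∈ Ω
    · simp [hw, hz, precompL_apply, mul_assoc]
    · simp [hw, hz]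
  have hR : convolution κ W (lsmul ℝ ℝ) volume x i =
      ∫ z in Ω, κ (x - z) • (fderiv ℝ θ z e • fn u z + θ z • grad u z i) := by
    have hex : Integrable fun t => κ (x - t) • W t :=
      ((hκc.convolutionExists_left (lsmul ℝ ℝ) hκ.continuous hWL) x).integrable_swap
    have h1 := ((EuclideanSpace.proj i : GradSpace n →L[ℂ] ℂ).restrictScalars ℝ).integral_comp_comm
      hex
    rw [convolution_eq_swap]
    refine h1.symm.trans ?_
    rw [← integral_indicator hΩ]
    refine integral_congr_ae (Eventually.of_forall fun z => ?_)
    by_cases hz : z ∈ Ω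
    · rw [Set.indicator_of_mem hz, ← cutoffGrad_apply hθ]
      simp [hW, hz]
    · simp [hW, hz]
  have hweak := u.2 (fun z => κ (x - z) * θ z) (hκx.mul hθ) hθc.mul_left hx i
  have hder : ∀ z, fderiv ℝ (fun z => κ (x - z) * θ z) z e =
      -(fderiv ℝ κ (x - z) e * θ z) + κ (x - z) * fderiv ℝ θ z e := by
    intro z
    have hd1 : HasFDerivAt (fun z => κ (x - z)) (-fderiv ℝ κ (x - z)) z := by
      have := ((hκ.differentiable (by simp)).differentiableAt (x := x - z)).hasFDerivAt.comp z
        ((hasFDerivAt_id z).const_sub x)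
      refine this.congr_fderiv ?_
      ext v
      simp
    have hd2 : HasFDerivAt θ (fderiv ℝ θ z) z :=
      (hθ.differentiable (by simp)).differentiableAt.hasFDerivAt
    change fderiv ℝ ((fun z => κ (x - z)) * θ) z e = _
    rw [(hd1.mul hd2).fderiv]
    simp
    ring
  have i1 : Integrable (fun z => (fderiv ℝ κ (x - z) e * θ z) • fn u z) (volume.restrict Ω) :=
    integrable_test_smul (hdκe.mul hθ.continuous) hθc.mul_left _
  have i2 : Integrable (fun z => (κ (x - z) * fderiv ℝ θ z e) • fn u z) (volume.restrict Ω) :=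
    integrable_test_smul (hκx.continuous.mul hdθe) (hθc.fderiv_apply ℝ e).mul_left _
  have i3 : Integrable (fun z => (κ (x - z) * θ z) • grad u z i) (volume.restrict Ω) :=
    ((EuclideanSpace.proj i : GradSpace n →L[ℂ] ℂ).restrictScalars ℝ).integrable_comp
      (integrable_test_smul (hκx.continuous.mul hθ.continuous) hθc.mul_left (grad u))
  have hweak' : -(∫ z in Ω, (fderiv ℝ κ (x - z) e * θ z) • fn u z) +
      (∫ z in Ω, (κ (x - z) * fderiv ℝ θ z e) • fn u z) =
      -∫ z in Ω, (κ (x - z) * θ z) • grad u z i := by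
    have hadd := integral_add i1.neg i2
    simp only [Pi.neg_apply] at hadd
    rw [← integral_neg, ← hadd]
    refine Eq.trans (integral_congr_ae (Eventually.of_forall fun z => ?_)) hweak
    dsimp only
    rw [hder, add_smul, neg_smul]
    rfl
  have hsplit : ∫ z in Ω, κ (x - z) • (fderiv ℝ θ z e • fn u z + θ z • grad u z i) =
      (∫ z in Ω, (κ (x - z) * fderiv ℝ θ z e) • fn u z) +
        ∫ z in Ω, (κ (x - z) * θ z) • grad u z i := by
    rw [← integral_add i2 i3]
    refine integral_congr_ae (Eventually.of_forall fun z => ?_)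
    simp only [smul_add, smul_smul]
  rw [hL, hR, hsplit]
  linear_combination -hweak'

end Cutoff

/-- The pair `(v, H)` is a limit in `L²(Ω)` of pairs `(φ, ∇φ)` with `φ` smooth on the whole
space. -/
def SmoothApprox {n : ℕ} (Ω : Set (Space n)) (v : Space n → ℂ) (H : Space n → GradSpace n) :
    Prop :=
  ∃ φ : ℕ → Space n → ℂ, (∀ k, ContDiff ℝ ∞ (φ k)) ∧
    Tendsto (fun k => eLpNorm (fun x => φ k x - v x) 2 (volume.restrict Ω)) atTop (𝓝 0) ∧
    Tendsto (fun k => eLpNorm (fun x => classicalGrad (φ k) x - H x) 2 (volume.restrict Ω))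
      atTop (𝓝 0)

theorem classicalGrad_add {n : ℕ} {φ ψ : Space n → ℂ} (hφ : ContDiff ℝ ∞ φ)
    (hψ : ContDiff ℝ ∞ ψ) (x : Space n) :
    classicalGrad (φ + ψ) x = classicalGrad φ x + classicalGrad ψ x := by
  ext i
  simp only [classicalGrad, PiLp.add_apply]
  rw [fderiv_add (hφ.differentiable (by simp)).differentiableAt
    (hψ.differentiable (by simp)).differentiableAt]
  rfl

theorem tendsto_eLpNorm_add {α F : Type*} [MeasurableSpace α] [NormedAddCommGroup F]
    {μ : Measure α} {f g : ℕ → α → F} (hf : ∀ k, AEStronglyMeasurable (f k) μ)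
    (hg : ∀ k, AEStronglyMeasurable (g k) μ) (h1 : Tendsto (fun k => eLpNorm (f k) 2 μ) atTop (𝓝 0))
    (h2 : Tendsto (fun k => eLpNorm (g k) 2 μ) atTop (𝓝 0)) :
    Tendsto (fun k => eLpNorm (f k + g k) 2 μ) atTop (𝓝 0) := by
  have := h1.add h2
  rw [add_zero] at this
  exact tendsto_of_tendsto_of_tendsto_of_le_of_le tendsto_const_nhds this (fun _ => zero_le)
    fun k => eLpNorm_add_le (hf k) (hg k) (by norm_num)

theorem SmoothApprox.zero {n : ℕ} (Ω : Set (Space n)) : SmoothApprox Ω 0 0 := by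
  refine ⟨fun _ => 0, fun _ => contDiff_const, by simp, ?_⟩
  have : classicalGrad (0 : Space n → ℂ) = 0 := by
    funext x
    ext i
    simp [classicalGrad]
  simp [this]

theorem SmoothApprox.add {n : ℕ} {Ω : Set (Space n)} {v v' : Space n → ℂ}
    {H H' : Space n → GradSpace n} (h : SmoothApprox Ω v H) (h' : SmoothApprox Ω v' H')
    (hv : AEStronglyMeasurable v (volume.restrict Ω))
    (hv' : AEStronglyMeasurable v' (volume.restrict Ω))
    (hH : AEStronglyMeasurable H (volume.restrict Ω))
    (hH' : AEStronglyMeasurable H' (volume.restrict Ω)) :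
    SmoothApprox Ω (v + v') (H + H') := by
  obtain ⟨φ, hφ, h1, h2⟩ := h
  obtain ⟨φ', hφ', h1', h2'⟩ := h'
  refine ⟨fun k => φ k + φ' k, fun k => (hφ k).add (hφ' k), ?_, ?_⟩
  · refine (tendsto_eLpNorm_add (fun k => (hφ k).continuous.aestronglyMeasurable.sub hv)
      (fun k => (hφ' k).continuous.aestronglyMeasurable.sub hv') h1 h1').congr fun k => ?_
    congr 1
    funext x
    simp only [Pi.add_apply, Pi.sub_apply]
    ring
  · refine (tendsto_eLpNorm_add
      (fun k => (continuous_classicalGrad (hφ k)).aestronglyMeasurable.sub hH)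
      (fun k => (continuous_classicalGrad (hφ' k)).aestronglyMeasurable.sub hH') h2 h2').congr
      fun k => ?_
    congr 1
    funext x
    simp only [Pi.add_apply, Pi.sub_apply, classicalGrad_add (hφ k) (hφ' k)]
    abel

theorem SmoothApprox.sum {n : ℕ} {Ω : Set (Space n)} {ι : Type*} (s : Finset ι)
    {v : ι → Space n → ℂ} {H : ι → Space n → GradSpace n}
    (h : ∀ i ∈ s, SmoothApprox Ω (v i) (H i))
    (hv : ∀ i, AEStronglyMeasurable (v i) (volume.restrict Ω))
    (hH : ∀ i, AEStronglyMeasurable (H i) (volume.restrict Ω)) :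
    SmoothApprox Ω (∑ i ∈ s, v i) (∑ i ∈ s, H i) := by
  classical
  induction s using Finset.induction_on with
  | empty => simpa using SmoothApprox.zero Ω
  | insert a s ha ih =>
    rw [Finset.sum_insert ha, Finset.sum_insert ha]
    exact (h a (Finset.mem_insert_self _ _)).add
      (ih fun i hi => h i (Finset.mem_insert_of_mem hi)) (hv a)
      (Finset.aestronglyMeasurable_sum s fun i _ => hv i) (hH a)
      (Finset.aestronglyMeasurable_sum s fun i _ => hH i)

theorem SmoothApprox.congr_ae {n : ℕ} {Ω : Set (Space n)} {v v' : Space n → ℂ}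
    {H H' : Space n → GradSpace n} (h : SmoothApprox Ω v H) (hv : v =ᵐ[volume.restrict Ω] v')
    (hH : H =ᵐ[volume.restrict Ω] H') : SmoothApprox Ω v' H' := by
  obtain ⟨φ, hφ, h1, h2⟩ := h
  refine ⟨φ, hφ, h1.congr fun k => eLpNorm_congr_ae ?_, h2.congr fun k => eLpNorm_congr_ae ?_⟩
  · filter_upwards [hv] with x hx
    rw [hx]
  · filter_upwards [hH] with x hx
    rw [hx]

/-- A smooth kernel of integral one concentrated near `-h`. -/
noncomputable def shiftedBump {n : ℕ} (ε : ℝ) (hε : 0 < ε) (h : Space n) (y : Space n) : ℝ :=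
  (⟨ε / 2, ε, by positivity, by linarith⟩ : ContDiffBump (0 : Space n)).normed volume (y + h)

section ShiftedBump

variable {n : ℕ} (ε : ℝ) (hε : 0 < ε) (h : Space n)

theorem contDiff_shiftedBump : ContDiff ℝ ∞ (shiftedBump ε hε h) :=
  (ContDiffBump.contDiff_normed _).comp (contDiff_id.add contDiff_const)

theorem hasCompactSupport_shiftedBump : HasCompactSupport (shiftedBump ε hε h) :=
  (ContDiffBump.hasCompactSupport_normed _).comp_homeomorph (Homeomorph.addRight h)

theorem shiftedBump_nonneg (y : Space n) : 0 ≤ shiftedBump ε hε h y :=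
  ContDiffBump.nonneg_normed _ _

theorem integral_shiftedBump : ∫ y, shiftedBump ε hε h y = 1 := by
  unfold shiftedBump
  rw [integral_add_right_eq_self]
  exact ContDiffBump.integral_normed _

theorem norm_add_lt_of_shiftedBump_ne_zero {y : Space n} (hy : shiftedBump ε hε h y ≠ 0) :
    ‖y + h‖ < ε := by
  have : y + h ∈ Function.support (ContDiffBump.normed
    (⟨ε / 2, ε, by positivity, by linarith⟩ : ContDiffBump (0 : Space n)) volume) := hy
  rw [ContDiffBump.support_normed_eq] at this
  simpa using this

end ShiftedBump

open ContinuousLinearMap in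
/-- Localized Sobolev functions on a domain with the cone property are approximable by smooth
functions. -/
theorem smoothApprox_cutoff {n : ℕ} {Ω : Set (Space n)} (hΩ : MeasurableSet Ω) {p e : Space n}
    {r δ : ℝ} (he : ‖e‖ ≤ 1) (hr : 0 < r) (hδ : 0 < δ) (hδ1 : δ ≤ 1)
    (hcone : ∀ x ∈ Ω, x ∈ Metric.ball p r → ∀ s, 0 < s → s < r →
      Metric.ball (x + s • e) (δ * s) ⊆ Ω)
    {θ : Space n → ℝ} (hθ : ContDiff ℝ ∞ θ) (hθs : tsupport θ ⊆ Metric.ball p (r / 2))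
    (u : H1 Ω) : SmoothApprox Ω (fun z => θ z • fn u z) (cutoffGrad θ u) := by
  have hθc : HasCompactSupport θ :=
    HasCompactSupport.of_support_subset_isCompact (isCompact_closedBall p (r / 2))
      ((subset_tsupport θ).trans (hθs.trans Metric.ball_subset_closedBall))
  -- The shift lengths tend to zero, and `s k ≤ r / 4` leaves room to pass from the ball of radius
  -- `r / 2` carrying `θ` to the ball of radius `r` where the cone condition holds.
  set s : ℕ → ℝ := fun k => r / 4 * (1 / ((k : ℝ) + 1)) with hs
  have hs0 : ∀ k, 0 < s k := fun k => by positivity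
  have hs4 : ∀ k, s k ≤ r / 4 := fun k => by
    refine mul_le_of_le_one_right (by positivity) ?_
    rw [div_le_one (by positivity)]
    linarith [Nat.cast_nonneg (α := ℝ) k]
  have hslim : Tendsto s atTop (𝓝 0) := by
    have := (tendsto_one_div_add_atTop_nhds_zero_nat (𝕜 := ℝ)).const_mul (r / 4)
    rwa [mul_zero] at this
  have hε0 : ∀ k, 0 < δ * s k / 2 := fun k => by have := hs0 k; positivity
  have hεs : ∀ k, δ * s k / 2 ≤ s k / 2 := fun k => by nlinarith [hs0 k]
  -- The kernel sits near `-s k • e`, so the convolution at `x` uses values near `x + s k • e`. Its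
  -- radius is half that of the cone ball, so that even the closed support lies in the open ball.
  set κ : ℕ → Space n → ℝ := fun k => shiftedBump (δ * s k / 2) (hε0 k) (s k • e) with hκ
  have hκC : ∀ k, ContDiff ℝ ∞ (κ k) := fun k => contDiff_shiftedBump _ _ _
  have hκc : ∀ k, HasCompactSupport (κ k) := fun k => hasCompactSupport_shiftedBump _ _ _
  have hse : ∀ k, ‖s k • e‖ ≤ s k := fun k => by
    rw [norm_smul, Real.norm_of_nonneg (hs0 k).le]
    exact mul_le_of_le_one_right (hs0 k).le he
  have hsupp : ∀ ε > 0, ∀ᶠ k in atTop, ∀ y, κ k y ≠ 0 → ‖y‖ < ε := by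
    intro ε hε
    filter_upwards [hslim.eventually_lt_const (show 0 < ε / 2 by positivity)] with k hk y hy
    have h1 := norm_add_lt_of_shiftedBump_ne_zero _ (hε0 k) _ hy
    have h2 := norm_sub_le (y + s k • e) (s k • e)
    rw [add_sub_cancel_right] at h2
    linarith [hse k, hεs k]
  -- If the support contains any point, that point is close to `p` because of `θ` and close to `x`
  -- because of `κ`. Hence `x` lies in the ball where the cone condition applies.
  have hts : ∀ k, ∀ x ∈ Ω, tsupport (fun z => κ k (x - z) * θ z) ⊆ Ω := by
    intro k x hx
    have hsub : tsupport (fun z => κ k (x - z) * θ z) ⊆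
        Metric.closedBall (x + s k • e) (δ * s k / 2) ∩ tsupport θ := by
      refine closure_minimal (fun z hz => ?_) (Metric.isClosed_closedBall.inter
        (isClosed_tsupport θ))
      rw [Function.mem_support] at hz
      refine ⟨?_, subset_tsupport θ (right_ne_zero_of_mul hz)⟩
      have := norm_add_lt_of_shiftedBump_ne_zero _ (hε0 k) _ (left_ne_zero_of_mul hz)
      rw [Metric.mem_closedBall, dist_comm, dist_eq_norm]
      rw [← sub_add_eq_add_sub]
      exact this.le
    intro z hz
    obtain ⟨hz1, hz2⟩ := hsub hz
    have hz3 := Metric.mem_ball.1 (hθs hz2)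
    rw [Metric.mem_closedBall] at hz1
    have hxp : x ∈ Metric.ball p r := by
      rw [Metric.mem_ball]
      have h1 : dist x (x + s k • e) ≤ s k := by
        rw [dist_eq_norm, sub_add_cancel_left, norm_neg]
        exact hse k
      have h2 := dist_triangle4 x (x + s k • e) z p
      rw [dist_comm (x + s k • e) z] at h2
      linarith [hεs k, hs4 k, hs0 k]
    refine hcone x hx hxp (s k) (hs0 k) (by linarith [hs4 k]) (Metric.mem_ball.2 ?_)
    linarith [hε0 k]
  have hw : MemLp (Ω.indicator fun z => θ z • fn u z) 2 volume :=
    (memLp_indicator_iff_restrict hΩ).2 (memLp_cutoff hθ hθc u)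
  have hW : MemLp (Ω.indicator (cutoffGrad θ u)) 2 volume :=
    (memLp_indicator_iff_restrict hΩ).2 (memLp_cutoffGrad hθ hθc u)
  have hws : StronglyMeasurable (Ω.indicator fun z => θ z • fn u z) :=
    (hθ.continuous.stronglyMeasurable.smul (Lp.stronglyMeasurable (fn u))).indicator hΩ
  have hWs : StronglyMeasurable (Ω.indicator (cutoffGrad θ u)) :=
    (stronglyMeasurable_cutoffGrad hθ u).indicator hΩ
  have hlim := tendsto_eLpNorm_convolution_sub hw hws (fun k => (hκC k).continuous) hκc
    (fun k => shiftedBump_nonneg _ _ _) (fun k => integral_shiftedBump _ _ _) hsupp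
  have hlim' := tendsto_eLpNorm_convolution_sub hW hWs (fun k => (hκC k).continuous) hκc
    (fun k => shiftedBump_nonneg _ _ _) (fun k => integral_shiftedBump _ _ _) hsupp
  refine ⟨fun k => convolution (κ k) (Ω.indicator fun z => θ z • fn u z) (lsmul ℝ ℝ) volume,
    fun k => (hκc k).contDiff_convolution_left _ (hκC k) (hw.locallyIntegrable (by norm_num)),
    ?_, ?_⟩
  · refine tendsto_of_tendsto_of_tendsto_of_le_of_le tendsto_const_nhds hlim (fun _ => zero_le)
      fun k => le_trans (le_of_eq (eLpNorm_congr_ae ?_)) (eLpNorm_mono_measure _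
        Measure.restrict_le_self)
    filter_upwards [ae_restrict_mem hΩ] with x hx
    rw [Set.indicator_of_mem hx]
  · refine tendsto_of_tendsto_of_tendsto_of_le_of_le tendsto_const_nhds hlim' (fun _ => zero_le)
      fun k => le_trans (le_of_eq (eLpNorm_congr_ae ?_)) (eLpNorm_mono_measure _
        Measure.restrict_le_self)
    filter_upwards [ae_restrict_mem hΩ] with x hx
    rw [Set.indicator_of_mem hx,
      classicalGrad_convolution_cutoff hΩ hθ hθc u (hκC k) (hκc k) x (hts k x hx)]

/-- Smooth functions on the whole space are dense in `H¹` of a Lipschitz domain. -/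
theorem IsLipschitzDomain.smoothApprox {n : ℕ} {Ω : Set (Space n)} (hΩ : IsLipschitzDomain Ω)
    (u : H1 Ω) : SmoothApprox Ω (fn u) (grad u) := by
  have hΩm : MeasurableSet Ω := hΩ.isOpen.measurableSet
  have hcpt : IsCompact (closure Ω) := hΩ.isBounded.isCompact_closure
  choose! e r δ he hr hδ hδ1 hcone using fun p (hp : p ∈ closure Ω) => hΩ.exists_cone hp
  obtain ⟨t, ht, hcov⟩ := hcpt.elim_nhds_subcover (fun p => Metric.ball p (r p / 2))
    fun p hp => Metric.ball_mem_nhds p (half_pos (hr p hp))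
  obtain ⟨f, hf⟩ := SmoothPartitionOfUnity.exists_isSubordinate (modelWithCornersSelf ℝ (Space n))
    (isClosed_closure (s := Ω)) (fun p : t => Metric.ball (p : Space n) (r p / 2))
    (fun p => Metric.isOpen_ball) (by rwa [Set.iUnion_subtype])
  have hfC : ∀ p, ContDiff ℝ ∞ (f p) := fun p => (f p).contMDiff.contDiff
  have hsum : ∀ x ∈ closure Ω, ∑ p, f p x = 1 := fun x hx => by
    rw [← finsum_eq_sum_of_fintype]
    exact f.sum_eq_one hx
  -- Since the cutoffs sum to one near each point of `Ω`, the terms `u ∇θ` in the local gradients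
  -- cancel in the sum.
  have hdsum : ∀ x ∈ Ω, ∀ v, ∑ p, fderiv ℝ (f p) x v = 0 := by
    intro x hx v
    have h1 : HasFDerivAt (fun y => ∑ p, f p y) (∑ p, fderiv ℝ (f p) x) x :=
      HasFDerivAt.fun_sum fun p _ =>
        ((hfC p).differentiable (by simp)).differentiableAt.hasFDerivAt
    have h2 : (fun y => ∑ p, f p y) =ᶠ[𝓝 x] fun _ => (1 : ℝ) := by
      filter_upwards [hΩ.isOpen.mem_nhds hx] with y hy using hsum y (subset_closure hy)
    have h3 := h1.unique ((hasFDerivAt_const (1 : ℝ) x).congr_of_eventuallyEq h2)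
    simpa using congrArg (fun L => L v) h3
  have happ := SmoothApprox.sum (Ω := Ω) Finset.univ (v := fun p z => f p z • fn u z)
    (H := fun p => cutoffGrad (f p) u)
    (fun p _ => smoothApprox_cutoff hΩm (he p (ht p p.2)) (hr p (ht p p.2)) (hδ p (ht p p.2))
      (hδ1 p (ht p p.2)) (hcone p (ht p p.2)) (hfC p) (hf p) u)
    (fun p => ((hfC p).continuous.stronglyMeasurable.smul
      (Lp.stronglyMeasurable (fn u))).aestronglyMeasurable)
    (fun p => (stronglyMeasurable_cutoffGrad (hfC p) u).aestronglyMeasurable)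
  refine happ.congr_ae ?_ ?_
  · filter_upwards [ae_restrict_mem hΩm] with x hx
    rw [Finset.sum_apply, ← Finset.sum_smul, hsum x (subset_closure hx), one_smul]
  · filter_upwards [ae_restrict_mem hΩm] with x hx
    ext i
    rw [Finset.sum_apply, WithLp.ofLp_sum, Finset.sum_apply]
    simp only [cutoffGrad_apply (hfC _)]
    rw [Finset.sum_add_distrib, ← Finset.sum_smul, ← Finset.sum_smul, hdsum x hx,
      hsum x (subset_closure hx), zero_smul, zero_add, one_smul]

/-! ### Existence, uniqueness and bounds of the trace -/

theorem tendsto_eLpNorm_of_tendsto_sub {α F : Type*} [MeasurableSpace α] [NormedAddCommGroup F]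
    {μ : Measure α} {f : ℕ → α → F} {g : α → F} (hf : ∀ k, AEStronglyMeasurable (f k) μ)
    (hg : AEStronglyMeasurable g μ) (hg2 : eLpNorm g 2 μ ≠ ⊤)
    (h : Tendsto (fun k => eLpNorm (fun x => f k x - g x) 2 μ) atTop (𝓝 0)) :
    Tendsto (fun k => eLpNorm (f k) 2 μ) atTop (𝓝 (eLpNorm g 2 μ)) := by
  have hlow : Tendsto (fun k => eLpNorm g 2 μ - eLpNorm (fun x => f k x - g x) 2 μ) atTop
      (𝓝 (eLpNorm g 2 μ)) := by
    simpa using ENNReal.Tendsto.sub tendsto_const_nhds h (Or.inl hg2)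
  have hup : Tendsto (fun k => eLpNorm (fun x => f k x - g x) 2 μ + eLpNorm g 2 μ) atTop
      (𝓝 (eLpNorm g 2 μ)) := by
    simpa using h.add_const (eLpNorm g 2 μ)
  refine tendsto_of_tendsto_of_tendsto_of_le_of_le hlow hup (fun k => ?_) fun k => ?_
  · refine tsub_le_iff_right.2 ?_
    have e : g = f k - fun x => f k x - g x := by
      funext x
      simp
    calc eLpNorm g 2 μ = eLpNorm (f k - fun x => f k x - g x) 2 μ := by rw [← e]
      _ ≤ _ := eLpNorm_sub_le (hf k) ((hf k).sub hg) (by norm_num)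
  · have e : f k = (fun x => f k x - g x) + g := by
      funext x
      simp
    calc eLpNorm (f k) 2 μ = eLpNorm ((fun x => f k x - g x) + g) 2 μ := by rw [← e]
      _ ≤ _ := eLpNorm_add_le ((hf k).sub hg) hg (by norm_num)

theorem classicalGrad_sub {n : ℕ} {φ ψ : Space n → ℂ} (hφ : ContDiff ℝ ∞ φ)
    (hψ : ContDiff ℝ ∞ ψ) (x : Space n) :
    classicalGrad (fun x => φ x - ψ x) x = classicalGrad φ x - classicalGrad ψ x := by
  ext i
  simp only [classicalGrad, PiLp.sub_apply]
  rw [fderiv_fun_sub (hφ.differentiable (by simp)).differentiableAt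
    (hψ.differentiable (by simp)).differentiableAt]
  rfl

theorem classicalGrad_sub_const {n : ℕ} (φ : Space n → ℂ) (c : ℂ) :
    classicalGrad (fun x => φ x - c) = classicalGrad φ := by
  funext x
  ext i
  simp [classicalGrad, fderiv_sub_const]

section Trace

variable {n : ℕ} {Ω : Set (Space n)}

theorem IsLipschitzDomain.exists_smooth_trace_eLpNorm_le (hΩ : IsLipschitzDomain Ω) :
    ∃ C : ℝ≥0∞, C ≠ ⊤ ∧ ∀ φ : Space n → ℂ, ContDiff ℝ ∞ φ →
      eLpNorm φ 2 (surfaceMeasure Ω) ^ 2 ≤ C * (eLpNorm φ 2 (volume.restrict Ω) ^ 2 +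
        eLpNorm φ 2 (volume.restrict Ω) * eLpNorm (classicalGrad φ) 2 (volume.restrict Ω)) := by
  obtain ⟨C, hC, h⟩ := hΩ.exists_smooth_trace_le
  refine ⟨C, hC, fun φ hφ => ?_⟩
  rw [eLpNorm_two_sq]
  refine (h φ hφ).trans (mul_le_mul_right (add_le_add (eLpNorm_two_sq φ).ge ?_) C)
  refine (ENNReal.pow_le_pow_left_iff two_ne_zero).1 ?_
  rw [mul_pow, eLpNorm_two_sq, eLpNorm_two_sq]
  exact sq_lintegral_mul_le hφ.continuous.enorm.aemeasurable
    (continuous_classicalGrad hφ).enorm.aemeasurable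

theorem IsLipschitzDomain.tendsto_eLpNorm_boundary (hΩ : IsLipschitzDomain Ω) {ι : Type*}
    {l : Filter ι} {φ : ι → Space n → ℂ} (hφ : ∀ k, ContDiff ℝ ∞ (φ k))
    (h1 : Tendsto (fun k => eLpNorm (φ k) 2 (volume.restrict Ω)) l (𝓝 0))
    (h2 : Tendsto (fun k => eLpNorm (classicalGrad (φ k)) 2 (volume.restrict Ω)) l (𝓝 0)) :
    Tendsto (fun k => eLpNorm (φ k) 2 (surfaceMeasure Ω)) l (𝓝 0) := by
  obtain ⟨C, hC, h⟩ := hΩ.exists_smooth_trace_eLpNorm_le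
  have hlim : Tendsto (fun k => C * (eLpNorm (φ k) 2 (volume.restrict Ω) ^ 2 +
      eLpNorm (φ k) 2 (volume.restrict Ω) * eLpNorm (classicalGrad (φ k)) 2 (volume.restrict Ω)))
      l (𝓝 0) := by
    have := ENNReal.Tendsto.const_mul (a := C)
      ((ENNReal.Tendsto.pow (n := 2) h1).add (ENNReal.Tendsto.mul h1 (by simp) h2 (by simp)))
      (Or.inr hC)
    simpa using this
  rw [ENNReal.tendsto_nhds_zero] at hlim ⊢
  intro ε hε
  filter_upwards [hlim (ε ^ 2) (by positivity)] with k hk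
  exact (ENNReal.pow_le_pow_left_iff two_ne_zero).1 ((h (φ k) (hφ k)).trans hk)

theorem IsLipschitzDomain.memLp_boundary (hΩ : IsLipschitzDomain Ω) {φ : Space n → ℂ}
    (hφ : Continuous φ) : MemLp φ 2 (surfaceMeasure Ω) := by
  have := hΩ.isFiniteMeasure_surfaceMeasure
  have hcpt : IsCompact (frontier Ω) := hΩ.isBounded.isCompact_closure.of_isClosed_subset
    isClosed_frontier frontier_subset_closure
  obtain ⟨M, hM⟩ := hcpt.exists_bound_of_continuousOn hφ.continuousOn
  refine MemLp.of_bound hφ.aestronglyMeasurable M ?_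
  exact (ae_restrict_iff' isClosed_frontier.measurableSet).2 (Eventually.of_forall hM)

/-- Two independent indices serve both purposes: `φ = φ'` yields the Cauchy property behind
existence of the trace, while two different sequences yield uniqueness along the diagonal. -/
theorem SmoothApprox.tendsto_sub {v : Space n → ℂ} {H : Space n → GradSpace n} {φ φ' : ℕ → Space n → ℂ}
    (hv : AEStronglyMeasurable v (volume.restrict Ω))
    (hH : AEStronglyMeasurable H (volume.restrict Ω))
    (hφ : ∀ k, ContDiff ℝ ∞ (φ k)) (hφ' : ∀ k, ContDiff ℝ ∞ (φ' k))
    (h1 : Tendsto (fun k => eLpNorm (fun x => φ k x - v x) 2 (volume.restrict Ω)) atTop (𝓝 0))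
    (h2 : Tendsto (fun k => eLpNorm (fun x => classicalGrad (φ k) x - H x) 2 (volume.restrict Ω))
      atTop (𝓝 0))
    (h1' : Tendsto (fun k => eLpNorm (fun x => φ' k x - v x) 2 (volume.restrict Ω)) atTop (𝓝 0))
    (h2' : Tendsto (fun k => eLpNorm (fun x => classicalGrad (φ' k) x - H x) 2
      (volume.restrict Ω)) atTop (𝓝 0)) :
    Tendsto (fun q : ℕ × ℕ => eLpNorm (fun x => φ q.1 x - φ' q.2 x) 2 (volume.restrict Ω))
      atTop (𝓝 0) ∧
    Tendsto (fun q : ℕ × ℕ => eLpNorm (classicalGrad fun x => φ q.1 x - φ' q.2 x) 2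
      (volume.restrict Ω)) atTop (𝓝 0) := by
  have hfst : Tendsto (Prod.fst : ℕ × ℕ → ℕ) atTop atTop := by
    rw [← prod_atTop_atTop_eq]; exact tendsto_fst
  have hsnd : Tendsto (Prod.snd : ℕ × ℕ → ℕ) atTop atTop := by
    rw [← prod_atTop_atTop_eq]; exact tendsto_snd
  constructor
  · have := (h1.comp hfst).add (h1'.comp hsnd)
    rw [add_zero] at this
    refine tendsto_of_tendsto_of_tendsto_of_le_of_le tendsto_const_nhds this (fun _ => zero_le)
      fun q => ?_
    refine le_trans (le_of_eq ?_) (eLpNorm_sub_le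
      ((hφ q.1).continuous.aestronglyMeasurable.sub hv)
      ((hφ' q.2).continuous.aestronglyMeasurable.sub hv) (by norm_num))
    congr 1
    funext x
    simp
  · have := (h2.comp hfst).add (h2'.comp hsnd)
    rw [add_zero] at this
    refine tendsto_of_tendsto_of_tendsto_of_le_of_le tendsto_const_nhds this (fun _ => zero_le)
      fun q => ?_
    refine le_trans (le_of_eq ?_) (eLpNorm_sub_le
      ((continuous_classicalGrad (hφ q.1)).aestronglyMeasurable.sub hH)
      ((continuous_classicalGrad (hφ' q.2)).aestronglyMeasurable.sub hH) (by norm_num))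
    congr 1
    funext x
    simp [classicalGrad_sub (hφ q.1) (hφ' q.2)]

/-- The trace inequality for differences turns convergence in `H¹` into a Cauchy sequence of
boundary values, and `L²` of the boundary is complete. -/
theorem IsLipschitzDomain.exists_isTrace (hΩ : IsLipschitzDomain Ω) (u : H1 Ω) :
    ∃ g, IsTrace Ω u g := by
  obtain ⟨φ, hφ, h1, h2⟩ := hΩ.smoothApprox u
  obtain ⟨d1, d2⟩ := SmoothApprox.tendsto_sub (Lp.aestronglyMeasurable (fn u))
    (Lp.aestronglyMeasurable (grad u)) hφ hφ h1 h2 h1 h2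
  have hd := hΩ.tendsto_eLpNorm_boundary (φ := fun q : ℕ × ℕ => fun x => φ q.1 x - φ q.2 x)
    (fun q => (hφ q.1).sub (hφ q.2)) d1 d2
  have hmem : ∀ k, MemLp (φ k) 2 (surfaceMeasure Ω) := fun k =>
    hΩ.memLp_boundary (hφ k).continuous
  have hcauchy : CauchySeq fun k => (hmem k).toLp (φ k) := by
    rw [EMetric.cauchySeq_iff]
    intro ε hε
    obtain ⟨⟨N, M⟩, hNM⟩ := eventually_atTop.1 (hd.eventually_lt_const hε)
    refine ⟨max N M, fun k hk l hl => ?_⟩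
    rw [Lp.edist_toLp_toLp]
    exact hNM (k, l) ⟨(le_max_left _ _).trans hk, (le_max_right _ _).trans hl⟩
  obtain ⟨g, hg⟩ := cauchySeq_tendsto_of_complete hcauchy
  refine ⟨g, φ, hφ, h1, h2, ?_⟩
  rw [tendsto_iff_edist_tendsto_0] at hg
  refine hg.congr fun k => ?_
  rw [Lp.edist_def]
  refine eLpNorm_congr_ae ?_
  filter_upwards [(hmem k).coeFn_toLp] with x hx
  simp [hx]

theorem IsLipschitzDomain.isTrace_unique (hΩ : IsLipschitzDomain Ω) {u : H1 Ω}
    {g g' : Lp ℂ 2 (surfaceMeasure Ω)} (h : IsTrace Ω u g) (h' : IsTrace Ω u g') : g = g' := by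
  obtain ⟨φ, hφ, h1, h2, h3⟩ := h
  obtain ⟨φ', hφ', h1', h2', h3'⟩ := h'
  obtain ⟨d1, d2⟩ := SmoothApprox.tendsto_sub (Lp.aestronglyMeasurable (fn u))
    (Lp.aestronglyMeasurable (grad u)) hφ hφ' h1 h2 h1' h2'
  have hd := hΩ.tendsto_eLpNorm_boundary (φ := fun q : ℕ × ℕ => fun x => φ q.1 x - φ' q.2 x)
    (fun q => (hφ q.1).sub (hφ' q.2)) d1 d2
  have hdiag : Tendsto (fun k : ℕ => (k, k)) atTop (atTop : Filter (ℕ × ℕ)) := by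
    rw [← prod_atTop_atTop_eq]
    exact tendsto_id.prodMk tendsto_id
  have hsum := (h3.add (hd.comp hdiag)).add h3'
  simp only [add_zero] at hsum
  rw [← edist_eq_zero, Lp.edist_def]
  refine le_antisymm (ge_of_tendsto' hsum fun k => ?_) zero_le
  have m1 : AEStronglyMeasurable (φ k) (surfaceMeasure Ω) := (hφ k).continuous.aestronglyMeasurable
  have m2 : AEStronglyMeasurable (φ' k) (surfaceMeasure Ω) :=
    (hφ' k).continuous.aestronglyMeasurable
  have mg := Lp.aestronglyMeasurable g
  have mg' := Lp.aestronglyMeasurable g'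
  have e : (g : Space n → ℂ) - g' =
      ((fun x => φ' k x - g' x) - fun x => φ k x - g x) + fun x => φ k x - φ' k x := by
    funext x
    simp only [Pi.sub_apply, Pi.add_apply]
    ring
  rw [e]
  refine (eLpNorm_add_le ((m2.sub mg').sub (m1.sub mg)) (m1.sub m2) (by norm_num)).trans ?_
  refine (add_le_add_left (eLpNorm_sub_le (m2.sub mg') (m1.sub mg) (by norm_num)) _).trans
    (le_of_eq ?_)
  simp only [Function.comp_apply]
  change eLpNorm (fun x => φ' k x - g' x) 2 _ + eLpNorm (fun x => φ k x - g x) 2 _ +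
    eLpNorm (fun x => φ k x - φ' k x) 2 _ = _
  ring

theorem IsLipschitzDomain.isTrace_trace (hΩ : IsLipschitzDomain Ω) (u : H1 Ω) :
    IsTrace Ω u (trace Ω u) :=
  Classical.epsilon_spec (hΩ.exists_isTrace u)

/-- The multiplicative trace inequality on `H¹(Ω)`. -/
theorem IsLipschitzDomain.exists_trace_eLpNorm_le (hΩ : IsLipschitzDomain Ω) :
    ∃ C : ℝ≥0∞, C ≠ ⊤ ∧ ∀ u : H1 Ω,
      eLpNorm (trace Ω u) 2 (surfaceMeasure Ω) ^ 2 ≤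
        C * (eLpNorm (fn u) 2 (volume.restrict Ω) ^ 2 +
          eLpNorm (fn u) 2 (volume.restrict Ω) * eLpNorm (grad u) 2 (volume.restrict Ω)) := by
  obtain ⟨C, hC, h⟩ := hΩ.exists_smooth_trace_eLpNorm_le
  refine ⟨C, hC, fun u => ?_⟩
  obtain ⟨φ, hφ, h1, h2, h3⟩ := hΩ.isTrace_trace u
  have hN := Lp.eLpNorm_ne_top (fn u)
  have hG := Lp.eLpNorm_ne_top (grad u)
  have t1 := tendsto_eLpNorm_of_tendsto_sub
    (fun k => (hφ k).continuous.aestronglyMeasurable) (Lp.aestronglyMeasurable (fn u)) hN h1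
  have t2 := tendsto_eLpNorm_of_tendsto_sub
    (fun k => (continuous_classicalGrad (hφ k)).aestronglyMeasurable)
    (Lp.aestronglyMeasurable (grad u)) hG h2
  have t3 := tendsto_eLpNorm_of_tendsto_sub
    (fun k => (hφ k).continuous.aestronglyMeasurable) (Lp.aestronglyMeasurable (trace Ω u))
    (Lp.eLpNorm_ne_top _) h3
  exact le_of_tendsto_of_tendsto' (ENNReal.Tendsto.pow t3)
    (ENNReal.Tendsto.const_mul ((ENNReal.Tendsto.pow t1).add
      (ENNReal.Tendsto.mul t1 (Or.inr hG) t2 (Or.inr hN))) (Or.inr hC)) fun k => h _ (hφ k)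

/-! ### The Friedrichs inequality -/

/-- The Friedrichs inequality for smooth functions: the boundary values on a set of positive
surface measure and the gradient control the function. -/
theorem IsLipschitzDomain.exists_smooth_friedrichs (hΩ : IsLipschitzDomain Ω) {S : Set (Space n)}
    (hS : surfaceMeasure Ω S ≠ 0) :
    ∃ C : ℝ≥0∞, C ≠ ⊤ ∧ ∀ φ : Space n → ℂ, ContDiff ℝ ∞ φ →
      ∫⁻ x in Ω, ‖φ x‖ₑ ^ 2 ≤ C * ((∫⁻ x in Ω, ‖classicalGrad φ x‖ₑ ^ 2) +
        ∫⁻ x in S, ‖φ x‖ₑ ^ 2 ∂(surfaceMeasure Ω)) := by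
  have := hΩ.isFiniteMeasure_surfaceMeasure
  obtain ⟨C₁, hC₁, htr⟩ := hΩ.exists_smooth_trace_le
  obtain ⟨C₂, hC₂, hosc⟩ := hΩ.oscBound
  have hΩf : volume Ω ≠ ⊤ := hΩ.isBounded.measure_lt_top.ne
  have hSf : surfaceMeasure Ω S ≠ ⊤ := measure_ne_top _ _
  refine ⟨(surfaceMeasure Ω S)⁻¹ * (2 * (C₁ * (2 * C₂ + volume Ω)) + 2 * volume Ω), ?_,
    fun φ hφ => ?_⟩
  · exact ENNReal.mul_ne_top (ENNReal.inv_ne_top.2 hS) (by finiteness)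
  have hc := hφ.continuous
  have hm : ∀ y, Measurable fun x => ‖φ y - φ x‖ₑ ^ 2 := fun y => by
    have h : Continuous fun x => φ y - φ x := by fun_prop
    exact h.enorm.measurable.pow_const 2
  have ho := hosc φ hφ
  set G := ∫⁻ x in Ω, ‖classicalGrad φ x‖ₑ ^ 2 with hG
  set B := ∫⁻ x in S, ‖φ x‖ₑ ^ 2 ∂(surfaceMeasure Ω) with hB
  have hab : ∀ a b : ℝ≥0∞, a * b ≤ a ^ 2 + b ^ 2 := fun a b => by
    rcases le_total a b with h | h
    · refine le_add_left ?_
      rw [sq]; gcongr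
    · refine le_add_right ?_
      rw [sq]; gcongr
  -- Apply the trace inequality to `φ - φ y`, which has the same gradient as `φ`; integration over
  -- `y` then produces the oscillation of `φ` on `Ω`.
  have hbd : ∀ y, ∫⁻ s in S, ‖φ y - φ s‖ₑ ^ 2 ∂(surfaceMeasure Ω) ≤
      C₁ * (2 * (∫⁻ x in Ω, ‖φ y - φ x‖ₑ ^ 2) + G) := by
    intro y
    refine (setLIntegral_le_lintegral _ _).trans ?_
    have h1 := htr (fun x => φ x - φ y) (hφ.sub contDiff_const)
    rw [classicalGrad_sub_const] at h1
    simp only [enorm_sub_rev (φ y)]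
    refine h1.trans (mul_le_mul_right ?_ C₁)
    rw [two_mul, add_assoc]
    gcongr
    have hm' : Measurable fun x => ‖φ x - φ y‖ₑ ^ 2 := by
      simpa only [enorm_sub_rev (φ y)] using hm y
    rw [hG, ← lintegral_add_left hm']
    exact lintegral_mono fun x => hab _ _
  have hint : ∫⁻ y in Ω, ∫⁻ s in S, ‖φ y - φ s‖ₑ ^ 2 ∂(surfaceMeasure Ω) ≤
      C₁ * ((2 * C₂ + volume Ω) * G) := by
    refine (lintegral_mono hbd).trans ?_
    rw [lintegral_const_mul' _ _ hC₁, lintegral_add_right _ measurable_const,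
      lintegral_const_mul' _ _ (by simp), setLIntegral_const]
    refine mul_le_mul_right ?_ C₁
    rw [add_mul, mul_comm G, mul_assoc]
    gcongr
  -- Average `|φ y|² ≤ 2 (|φ y - φ s|² + |φ s|²)` over `s` in `S`. Positivity of the measure of `S`
  -- allows the division that follows.
  have hmain : surfaceMeasure Ω S * ∫⁻ y in Ω, ‖φ y‖ₑ ^ 2 ≤
      2 * (C₁ * ((2 * C₂ + volume Ω) * G)) + 2 * (volume Ω * B) := by
    calc surfaceMeasure Ω S * ∫⁻ y in Ω, ‖φ y‖ₑ ^ 2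
        = ∫⁻ y in Ω, ∫⁻ s in S, ‖φ y‖ₑ ^ 2 ∂(surfaceMeasure Ω) := by
          simp only [setLIntegral_const]
          rw [lintegral_mul_const' _ _ hSf, mul_comm]
      _ ≤ ∫⁻ y in Ω, ∫⁻ s in S, 2 * (‖φ y - φ s‖ₑ ^ 2 + ‖φ s‖ₑ ^ 2) ∂(surfaceMeasure Ω) := by
          refine lintegral_mono fun y => lintegral_mono fun s => ?_
          simpa using enorm_sub_sq_le (φ y) (φ s) 0
      _ = 2 * ((∫⁻ y in Ω, ∫⁻ s in S, ‖φ y - φ s‖ₑ ^ 2 ∂(surfaceMeasure Ω)) + volume Ω * B) := by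
          have : ∀ y, ∫⁻ s in S, 2 * (‖φ y - φ s‖ₑ ^ 2 + ‖φ s‖ₑ ^ 2) ∂(surfaceMeasure Ω) =
              2 * ((∫⁻ s in S, ‖φ y - φ s‖ₑ ^ 2 ∂(surfaceMeasure Ω)) + B) := fun y => by
            rw [lintegral_const_mul' _ _ (by simp), lintegral_add_left (hm y)]
          simp only [this]
          rw [lintegral_const_mul' _ _ (by simp), lintegral_add_right _ measurable_const,
            setLIntegral_const, mul_comm B]
      _ ≤ _ := by
          rw [mul_add]
          gcongr
  generalize ∫⁻ y in Ω, ‖φ y‖ₑ ^ 2 = X at *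
  calc X = (surfaceMeasure Ω S)⁻¹ * (surfaceMeasure Ω S * X) := by
        rw [← mul_assoc, ENNReal.inv_mul_cancel hS hSf, one_mul]
    _ ≤ (surfaceMeasure Ω S)⁻¹ *
        (2 * (C₁ * ((2 * C₂ + volume Ω) * G)) + 2 * (volume Ω * B)) := mul_le_mul_right hmain _
    _ ≤ _ := by
        rw [mul_assoc]
        refine mul_le_mul_right ?_ _
        calc 2 * (C₁ * ((2 * C₂ + volume Ω) * G)) + 2 * (volume Ω * B)
            = 2 * (C₁ * (2 * C₂ + volume Ω)) * G + 2 * volume Ω * B := by ring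
          _ ≤ (2 * (C₁ * (2 * C₂ + volume Ω)) + 2 * volume Ω) * G +
              (2 * (C₁ * (2 * C₂ + volume Ω)) + 2 * volume Ω) * B := by
              gcongr
              · exact le_self_add
              · exact le_add_self
          _ = _ := by ring

/-- The Friedrichs inequality on functions whose trace vanishes on a set of positive surface
measure. -/
theorem IsLipschitzDomain.exists_friedrichs (hΩ : IsLipschitzDomain Ω) {S : Set (Space n)}
    (hS : surfaceMeasure Ω S ≠ 0) :
    ∃ C : ℝ≥0∞, C ≠ ⊤ ∧ ∀ u ∈ V Ω S,
      eLpNorm (fn u) 2 (volume.restrict Ω) ^ 2 ≤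
        C * eLpNorm (grad u) 2 (volume.restrict Ω) ^ 2 := by
  obtain ⟨C, hC, h⟩ := hΩ.exists_smooth_friedrichs hS
  refine ⟨C, hC, fun u hu => ?_⟩
  obtain ⟨φ, hφ, h1, h2, h3⟩ := hΩ.isTrace_trace u
  have hN := Lp.eLpNorm_ne_top (fn u)
  have hG := Lp.eLpNorm_ne_top (grad u)
  have t1 := tendsto_eLpNorm_of_tendsto_sub
    (fun k => (hφ k).continuous.aestronglyMeasurable) (Lp.aestronglyMeasurable (fn u)) hN h1
  have t2 := tendsto_eLpNorm_of_tendsto_sub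
    (fun k => (continuous_classicalGrad (hφ k)).aestronglyMeasurable)
    (Lp.aestronglyMeasurable (grad u)) hG h2
  -- On `S` the trace vanishes, so the boundary values of the approximants tend to zero there and
  -- the boundary term drops out in the limit.
  have h3' : Tendsto (fun k => eLpNorm (φ k) 2 ((surfaceMeasure Ω).restrict S)) atTop (𝓝 0) := by
    refine tendsto_of_tendsto_of_tendsto_of_le_of_le tendsto_const_nhds h3 (fun _ => zero_le)
      fun k => le_trans (le_of_eq (eLpNorm_congr_ae ?_)) (eLpNorm_mono_measure _
        Measure.restrict_le_self)
    filter_upwards [hu] with x hx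
    rw [hx, sub_zero]
  have hlim := le_of_tendsto_of_tendsto' (ENNReal.Tendsto.pow (n := 2) t1)
    (ENNReal.Tendsto.const_mul (a := C) ((ENNReal.Tendsto.pow (n := 2) t2).add
      (ENNReal.Tendsto.pow (n := 2) h3')) (Or.inr hC)) fun k => by
        rw [eLpNorm_two_sq, eLpNorm_two_sq, eLpNorm_two_sq]
        exact h _ (hφ k)
  simpa using hlim

end Trace

/-! ### Continuity and lower bound of the form -/

/-- Hölder with exponents `∞, 2, 2`. Vector-valued `p` and `q` let it cover the gradient term as
well as the boundary and mass terms. -/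
theorem enorm_integral_le_of_ae_enorm_le {α F F' : Type*} [MeasurableSpace α]
    [NormedAddCommGroup F] [NormedAddCommGroup F'] {μ : Measure α} {f : α → ℂ} {p : α → F}
    {q : α → F'} {M : ℝ≥0∞} (hM : M ≠ ⊤) (hp : AEStronglyMeasurable p μ)
    (hq : AEStronglyMeasurable q μ) (h : ∀ᵐ x ∂μ, ‖f x‖ₑ ≤ M * (‖p x‖ₑ * ‖q x‖ₑ)) :
    ‖∫ x, f x ∂μ‖ₑ ≤ M * (eLpNorm p 2 μ * eLpNorm q 2 μ) := by
  refine (enorm_integral_le_lintegral_enorm _).trans ((lintegral_mono_ae h).trans ?_)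
  rw [lintegral_const_mul' _ _ hM]
  refine mul_le_mul_right ((ENNReal.pow_le_pow_left_iff two_ne_zero).1 ?_) M
  rw [mul_pow, eLpNorm_two_sq, eLpNorm_two_sq]
  exact sq_lintegral_mul_le hp.enorm hq.enorm

theorem integral_norm_sq_eq {α F : Type*} [MeasurableSpace α] [NormedAddCommGroup F]
    {μ : Measure α} {f : α → F} (hf : AEStronglyMeasurable f μ) :
    ∫ x, ‖f x‖ ^ 2 ∂μ = (eLpNorm f 2 μ).toReal ^ 2 := by
  have hm : AEStronglyMeasurable (fun x => ‖f x‖ ^ 2) μ := hf.norm.pow 2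
  rw [integral_eq_lintegral_of_nonneg_ae (Eventually.of_forall fun x => by positivity) hm, ← ENNReal.toReal_pow, eLpNorm_two_sq]
  congr 1
  refine lintegral_congr fun x => ?_
  rw [ENNReal.ofReal_pow (norm_nonneg _), ofReal_norm]

theorem MemLp.integrable_norm_sq {α F : Type*} [MeasurableSpace α] [NormedAddCommGroup F]
    {μ : Measure α} {f : α → F} (hf : MemLp f 2 μ) : Integrable (fun x => ‖f x‖ ^ 2) μ :=
  (memLp_two_iff_integrable_sq_norm hf.1).1 hf

/-- Real numbers are only conditionally complete, so the essential infimum is a lower bound only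
once some almost everywhere lower bound is known. Essential boundedness of `c` supplies one. -/
theorem ae_essInf_re_le {α : Type*} [MeasurableSpace α] {μ : Measure α} {c : α → ℂ}
    (hc : MemLp c ∞ μ) : ∀ᵐ x ∂μ, essInf (fun x => (c x).re) μ ≤ (c x).re := by
  have hb : ∀ᵐ x ∂μ, -(eLpNorm c ∞ μ).toReal ≤ (c x).re := by
    filter_upwards [enorm_ae_le_eLpNormEssSup c μ] with x hx
    have h1 : ‖c x‖ ≤ (eLpNorm c ∞ μ).toReal := by
      rw [← toReal_enorm]
      exact ENNReal.toReal_mono hc.2.ne (by rwa [eLpNorm_exponent_top])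
    exact (abs_le.1 ((Complex.abs_re_le_norm _).trans h1)).1
  exact ae_essInf_le ⟨_, hb⟩

/-- Lower bound for the real part of a weighted squared norm. -/
theorem le_re_integral_mul_norm_sq {α F : Type*} [MeasurableSpace α] [NormedAddCommGroup F]
    {μ : Measure α} {c : α → ℂ} {f : α → F} {b : ℝ} (hc : MemLp c ∞ μ) (hf : MemLp f 2 μ)
    (hb : ∀ᵐ x ∂μ, b ≤ (c x).re) :
    b * ∫ x, ‖f x‖ ^ 2 ∂μ ≤ (∫ x, c x * ((‖f x‖ ^ 2 : ℝ) : ℂ) ∂μ).re := by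
  have hfi := MemLp.integrable_norm_sq hf
  have hfi' : Integrable (fun x => ((‖f x‖ ^ 2 : ℝ) : ℂ)) μ := hfi.ofReal
  have hi : Integrable (fun x => c x * ((‖f x‖ ^ 2 : ℝ) : ℂ)) μ :=
    memLp_one_iff_integrable.1 ((memLp_one_iff_integrable.2 hfi').mul hc)
  have hre : (∫ x, c x * ((‖f x‖ ^ 2 : ℝ) : ℂ) ∂μ).re = ∫ x, (c x).re * ‖f x‖ ^ 2 ∂μ := by
    have := integral_re hi
    simp only [RCLike.re_to_complex] at this
    rw [← this]
    refine integral_congr_ae (Eventually.of_forall fun x => ?_)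
    simp only [Complex.re_mul_ofReal]
  have hi' : Integrable (fun x => (c x).re * ‖f x‖ ^ 2) μ := by
    refine hi.re.congr (Eventually.of_forall fun x => ?_)
    simp only [RCLike.re_to_complex, Complex.re_mul_ofReal]
  rw [hre, ← integral_const_mul]
  refine integral_mono_ae (hfi.const_mul b) hi' ?_
  filter_upwards [hb] with x hx
  exact mul_le_mul_of_nonneg_right hx (by positivity)

section Form

variable {n : ℕ} {Ω : Set (Space n)}

theorem norm_sq_H1 (u : H1 Ω) : ‖u‖ ^ 2 = ‖fn u‖ ^ 2 + ‖grad u‖ ^ 2 :=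
  WithLp.prod_norm_sq_eq_of_L2 _

theorem norm_fn_le (u : H1 Ω) : ‖fn u‖ ≤ ‖u‖ :=
  abs_le_of_sq_le_sq' (by rw [norm_sq_H1]; linarith [sq_nonneg ‖grad u‖]) (norm_nonneg _) |>.2

theorem norm_grad_le (u : H1 Ω) : ‖grad u‖ ≤ ‖u‖ :=
  abs_le_of_sq_le_sq' (by rw [norm_sq_H1]; linarith [sq_nonneg ‖fn u‖]) (norm_nonneg _) |>.2

theorem IsLipschitzDomain.exists_norm_trace_sq_le (hΩ : IsLipschitzDomain Ω) :
    ∃ C : ℝ, 0 ≤ C ∧ ∀ u : H1 Ω, ‖trace Ω u‖ ^ 2 ≤ C * ‖fn u‖ * ‖u‖ := by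
  obtain ⟨C, hC, h⟩ := hΩ.exists_trace_eLpNorm_le
  refine ⟨C.toReal * 2, by positivity, fun u => ?_⟩
  have h1 := ENNReal.toReal_mono (by have := Lp.eLpNorm_ne_top (fn u);
                                     have := Lp.eLpNorm_ne_top (grad u); finiteness) (h u)
  rw [ENNReal.toReal_pow, ENNReal.toReal_mul, ENNReal.toReal_add
    (by have := Lp.eLpNorm_ne_top (fn u); finiteness)
    (by have := Lp.eLpNorm_ne_top (fn u); have := Lp.eLpNorm_ne_top (grad u); finiteness),
    ENNReal.toReal_pow, ENNReal.toReal_mul, ← Lp.norm_def, ← Lp.norm_def, ← Lp.norm_def] at h1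
  refine h1.trans ?_
  rw [mul_assoc, mul_assoc]
  refine mul_le_mul_of_nonneg_left ?_ ENNReal.toReal_nonneg
  nlinarith [mul_le_mul_of_nonneg_left (norm_fn_le u) (norm_nonneg (fn u)),
    mul_le_mul_of_nonneg_left (norm_grad_le u) (norm_nonneg (fn u))]

theorem IsLipschitzDomain.exists_multTraceIneq (hΩ : IsLipschitzDomain Ω) (S : Set (Space n)) :
    ∃ C, MultTraceIneq Ω S C := by
  obtain ⟨C, -, h⟩ := hΩ.exists_norm_trace_sq_le
  refine ⟨C, fun u => le_trans ?_ (h u)⟩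
  rw [Lp.norm_def, ← integral_norm_sq_eq (Lp.aestronglyMeasurable _)]
  exact setIntegral_le_integral (MemLp.integrable_norm_sq (Lp.memLp _))
    (Eventually.of_forall fun x => by positivity)

theorem enorm_sum_mul_star_le (p q : GradSpace n) :
    ‖∑ i, p i * star (q i)‖ₑ ≤ ‖p‖ₑ * ‖q‖ₑ := by
  have h : ∑ i, p i * star (q i) = inner ℂ q p := by
    rw [PiLp.inner_apply]
    rfl
  rw [h, ← ofReal_norm, ← ofReal_norm, ← ofReal_norm, ← ENNReal.ofReal_mul (norm_nonneg _),
    mul_comm]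
  exact ENNReal.ofReal_le_ofReal (norm_inner_le_norm q p)

theorem sum_mul_star_self (p : GradSpace n) :
    ∑ i, p i * star (p i) = ((‖p‖ ^ 2 : ℝ) : ℂ) := by
  have h : ∑ i, p i * star (p i) = inner ℂ p p := by
    rw [PiLp.inner_apply]
    rfl
  rw [h, inner_self_eq_norm_sq_to_K]
  norm_cast

theorem mul_star_self_eq (z : ℂ) : z * star z = ((‖z‖ ^ 2 : ℝ) : ℂ) := by
  rw [Complex.star_def, Complex.mul_conj, Complex.normSq_eq_norm_sq]

theorem IsLipschitzDomain.exists_norm_shiftedForm_le (hΩ : IsLipschitzDomain Ω)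
    {ΓR : Set (Space n)} {a c : Space n → ℂ} (ha : MemLp a ∞ (volume.restrict Ω))
    (hc : MemLp c ∞ ((surfaceMeasure Ω).restrict ΓR)) (L : ℝ) :
    ∃ C > (0 : ℝ), ∀ u v : H1 Ω, ‖shiftedForm Ω ΓR a c L u v‖ ≤ C * ‖u‖ * ‖v‖ := by
  obtain ⟨C, hC0, htr⟩ := hΩ.exists_norm_trace_sq_le
  have htr' : ∀ u : H1 Ω, ‖trace Ω u‖ ≤ √C * ‖u‖ := fun u => by
    refine abs_le_of_sq_le_sq' ?_ (by positivity) |>.2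
    rw [mul_pow, Real.sq_sqrt hC0]
    refine (htr u).trans ?_
    rw [mul_assoc, sq]
    gcongr
    exact norm_fn_le u
  set Ma := (eLpNorm a ∞ (volume.restrict Ω)).toReal with hMa
  set Mc := (eLpNorm c ∞ ((surfaceMeasure Ω).restrict ΓR)).toReal with hMc
  refine ⟨Ma + Mc * C + |L| + 1, by positivity, fun u v => ?_⟩
  have hgrad : ‖∫ x in Ω, a x * ∑ i, grad u x i * star (grad v x i)‖ ≤
      Ma * (‖grad u‖ * ‖grad v‖) := by
    have := enorm_integral_le_of_ae_enorm_le
      (f := fun x => a x * ∑ i, grad u x i * star (grad v x i)) ha.2.ne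
      (Lp.aestronglyMeasurable (grad u)) (Lp.aestronglyMeasurable (grad v)) (by
        filter_upwards [enorm_ae_le_eLpNormEssSup a (volume.restrict Ω)] with x hx
        rw [enorm_mul, eLpNorm_exponent_top]
        exact mul_le_mul' hx (enorm_sum_mul_star_le _ _))
    rw [← toReal_enorm, Lp.norm_def, Lp.norm_def, ← ENNReal.toReal_mul, ← ENNReal.toReal_mul]
    exact ENNReal.toReal_mono (ENNReal.mul_ne_top ha.2.ne (ENNReal.mul_ne_top
      (Lp.eLpNorm_ne_top _) (Lp.eLpNorm_ne_top _))) this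
  have hbdry : ‖∫ x in ΓR, c x * trace Ω u x * star (trace Ω v x) ∂(surfaceMeasure Ω)‖ ≤
      Mc * (‖trace Ω u‖ * ‖trace Ω v‖) := by
    have := enorm_integral_le_of_ae_enorm_le
      (f := fun x => c x * trace Ω u x * star (trace Ω v x)) hc.2.ne
      (Lp.aestronglyMeasurable (trace Ω u)).restrict
      (Lp.aestronglyMeasurable (trace Ω v)).restrict (by
        filter_upwards [enorm_ae_le_eLpNormEssSup c ((surfaceMeasure Ω).restrict ΓR)] with x hx
        have hs : ‖star (trace Ω v x)‖ₑ = ‖trace Ω v x‖ₑ := by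
          rw [← ofReal_norm, norm_star, ofReal_norm]
        rw [enorm_mul, enorm_mul, eLpNorm_exponent_top, hs, mul_assoc]
        exact mul_le_mul_left hx _)
    rw [← toReal_enorm, Lp.norm_def, Lp.norm_def, ← ENNReal.toReal_mul, ← ENNReal.toReal_mul]
    refine ENNReal.toReal_mono (ENNReal.mul_ne_top hc.2.ne (ENNReal.mul_ne_top
      (Lp.eLpNorm_ne_top _) (Lp.eLpNorm_ne_top _))) (this.trans ?_)
    gcongr <;> exact Measure.restrict_le_self
  have hmass : ‖∫ x in Ω, fn u x * star (fn v x)‖ ≤ ‖fn u‖ * ‖fn v‖ := by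
    have := enorm_integral_le_of_ae_enorm_le (M := 1)
      (f := fun x => fn u x * star (fn v x)) (by simp)
      (Lp.aestronglyMeasurable (fn u)) (Lp.aestronglyMeasurable (fn v)) (by
        refine Eventually.of_forall fun x => ?_
        have hs : ‖star (fn v x)‖ₑ = ‖fn v x‖ₑ := by
          rw [← ofReal_norm, norm_star, ofReal_norm]
        rw [enorm_mul, hs, one_mul])
    rw [one_mul] at this
    rw [← toReal_enorm, Lp.norm_def, Lp.norm_def, ← ENNReal.toReal_mul]
    exact ENNReal.toReal_mono (ENNReal.mul_ne_top
      (Lp.eLpNorm_ne_top _) (Lp.eLpNorm_ne_top _)) this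
  have b1 : ‖grad u‖ * ‖grad v‖ ≤ ‖u‖ * ‖v‖ := by
    gcongr <;> exact norm_grad_le _
  have b2 : ‖fn u‖ * ‖fn v‖ ≤ ‖u‖ * ‖v‖ := by
    gcongr <;> exact norm_fn_le _
  have b3 : ‖trace Ω u‖ * ‖trace Ω v‖ ≤ C * (‖u‖ * ‖v‖) := by
    calc ‖trace Ω u‖ * ‖trace Ω v‖ ≤ (√C * ‖u‖) * (√C * ‖v‖) :=
          mul_le_mul (htr' u) (htr' v) (norm_nonneg _) (by positivity)
      _ = (√C) ^ 2 * (‖u‖ * ‖v‖) := by ring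
      _ = _ := by rw [Real.sq_sqrt hC0]
  calc ‖shiftedForm Ω ΓR a c L u v‖
      ≤ ‖∫ x in Ω, a x * ∑ i, grad u x i * star (grad v x i)‖ +
        ‖∫ x in ΓR, c x * trace Ω u x * star (trace Ω v x) ∂(surfaceMeasure Ω)‖ +
        |L| * ‖∫ x in Ω, fn u x * star (fn v x)‖ := by
        refine (norm_add_le _ _).trans (add_le_add (norm_add_le _ _) (le_of_eq ?_))
        rw [norm_mul, Complex.norm_real, Real.norm_eq_abs]
    _ ≤ Ma * (‖u‖ * ‖v‖) + Mc * (C * (‖u‖ * ‖v‖)) + |L| * (‖u‖ * ‖v‖) := by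
        refine add_le_add (add_le_add (hgrad.trans ?_) (hbdry.trans ?_)) ?_
        · exact mul_le_mul_of_nonneg_left b1 ENNReal.toReal_nonneg
        · exact mul_le_mul_of_nonneg_left b3 ENNReal.toReal_nonneg
        · exact mul_le_mul_of_nonneg_left (hmass.trans b2) (abs_nonneg L)
    _ ≤ _ := by
        have : 0 ≤ ‖u‖ * ‖v‖ := by positivity
        nlinarith

/-- Reduces coercivity to an inequality between real numbers: each coefficient is replaced by a
lower bound of its real part. -/
theorem le_re_shiftedForm_self {ΓR : Set (Space n)} {a c : Space n → ℂ} {α₀ : ℝ}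
    (ha : MemLp a ∞ (volume.restrict Ω))
    (ha_re : α₀ ≤ essInf (fun x => (a x).re) (volume.restrict Ω))
    (hc : MemLp c ∞ ((surfaceMeasure Ω).restrict ΓR)) (L : ℝ) (u : H1 Ω) :
    α₀ * ‖grad u‖ ^ 2 +
      robinInf Ω ΓR c * ∫ x in ΓR, ‖trace Ω u x‖ ^ 2 ∂(surfaceMeasure Ω) + L * ‖fn u‖ ^ 2 ≤
      (shiftedForm Ω ΓR a c L u u).re := by
  have h1 : α₀ * ‖grad u‖ ^ 2 ≤ (∫ x in Ω, a x * ∑ i, grad u x i * star (grad u x i)).re := by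
    simp only [sum_mul_star_self]
    rw [Lp.norm_def, ← integral_norm_sq_eq (Lp.aestronglyMeasurable _)]
    refine le_re_integral_mul_norm_sq ha (Lp.memLp (grad u)) ?_
    filter_upwards [ae_essInf_re_le ha] with x hx using ha_re.trans hx
  have h2 : robinInf Ω ΓR c * ∫ x in ΓR, ‖trace Ω u x‖ ^ 2 ∂(surfaceMeasure Ω) ≤
      (∫ x in ΓR, c x * trace Ω u x * star (trace Ω u x) ∂(surfaceMeasure Ω)).re := by
    simp only [mul_assoc, mul_star_self_eq]
    exact le_re_integral_mul_norm_sq hc ((Lp.memLp (trace Ω u)).restrict ΓR) (ae_essInf_re_le hc)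
  have h3 : ((L : ℂ) * ∫ x in Ω, fn u x * star (fn u x)).re = L * ‖fn u‖ ^ 2 := by
    simp only [mul_star_self_eq]
    rw [integral_complex_ofReal, ← Complex.ofReal_mul, Complex.ofReal_re, Lp.norm_def,
      ← integral_norm_sq_eq (Lp.aestronglyMeasurable _)]
  rw [shiftedForm, form, Complex.add_re, Complex.add_re, h3]
  linarith

end Form

end RobinForm

/-! ### The main theorem -/

theorem lemma2p1 (n : ℕ) (Ω ΓD ΓR : Set (RobinForm.Space n))
    (hΩ : RobinForm.IsLipschitzDomain Ω)
    (hDmeas : NullMeasurableSet ΓD (RobinForm.surfaceMeasure Ω))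
    (hRmeas : NullMeasurableSet ΓR (RobinForm.surfaceMeasure Ω))
    (hdisj : Disjoint ΓD ΓR) (hunion : ΓD ∪ ΓR = frontier Ω)
    (hRpos : 0 < RobinForm.surfaceMeasure Ω ΓR)
    (a c : RobinForm.Space n → ℂ) (α₀ : ℝ) (hα₀ : 0 < α₀)
    (ha : MemLp a ∞ (volume.restrict Ω))
    (ha_re : α₀ ≤ essInf (fun x => (a x).re) (volume.restrict Ω))
    (hc : MemLp c ∞ ((RobinForm.surfaceMeasure Ω).restrict ΓR)) :
    (∀ u : RobinForm.H1 Ω, ∃! g, RobinForm.IsTrace Ω u g) ∧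
    (∃ Ctrace : ℝ, RobinForm.MultTraceIneq Ω ΓR Ctrace) ∧
    ∀ Ctrace : ℝ, RobinForm.MultTraceIneq Ω ΓR Ctrace →
      ∃ Ccont > (0 : ℝ), ∃ ccoer > (0 : ℝ),
        (∀ u ∈ RobinForm.V Ω ΓD, ∀ v ∈ RobinForm.V Ω ΓD,
          ‖RobinForm.shiftedForm Ω ΓR a c
            (RobinForm.shift α₀ (RobinForm.robinInf Ω ΓR c) Ctrace
              (RobinForm.surfaceMeasure Ω ΓD)) u v‖ ≤ Ccont * ‖u‖ * ‖v‖) ∧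
        (∀ u ∈ RobinForm.V Ω ΓD,
          ccoer * ‖u‖ ^ 2 ≤ (RobinForm.shiftedForm Ω ΓR a c
            (RobinForm.shift α₀ (RobinForm.robinInf Ω ΓR c) Ctrace
              (RobinForm.surfaceMeasure Ω ΓD)) u u).re) := by
  refine ⟨fun u => ?_, hΩ.exists_multTraceIneq ΓR, fun C hC => ?_⟩
  · obtain ⟨g, hg⟩ := hΩ.exists_isTrace u
    exact ⟨g, hg, fun g' hg' => hΩ.isTrace_unique hg' hg⟩
  set c₀ := RobinForm.robinInf Ω ΓR c with hc₀
  set L := RobinForm.shift α₀ c₀ C (RobinForm.surfaceMeasure Ω ΓD) with hL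
  obtain ⟨K, hK, hcont⟩ := hΩ.exists_norm_shiftedForm_le ha hc L
  refine ⟨K, hK, ?_⟩
  suffices h : ∃ k > (0 : ℝ), ∀ u ∈ RobinForm.V Ω ΓD, k * ‖u‖ ^ 2 ≤
      α₀ * ‖RobinForm.grad u‖ ^ 2 +
        c₀ * ∫ x in ΓR, ‖RobinForm.trace Ω u x‖ ^ 2 ∂(RobinForm.surfaceMeasure Ω) +
        L * ‖RobinForm.fn u‖ ^ 2 by
    obtain ⟨k, hk, h⟩ := h
    exact ⟨k, hk, fun u _ v _ => hcont u v, fun u hu =>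
      (h u hu).trans (RobinForm.le_re_shiftedForm_self ha ha_re hc L u)⟩
  have hS : ∀ u : RobinForm.H1 Ω,
      0 ≤ ∫ x in ΓR, ‖RobinForm.trace Ω u x‖ ^ 2 ∂(RobinForm.surfaceMeasure Ω) :=
    fun u => integral_nonneg fun x => by positivity
  rcases lt_or_ge c₀ 0 with hneg | hnonneg
  -- The summand `α₀` of the shift completes `α₀ ‖∇u‖²` to `α₀ ‖u‖²_{H¹}`. The other summand is what
  -- completes the square `h3`, at a cost of `α₀ / 4` of the full norm. No sign of `C` is used, and
  -- `α₀ / 2` is not the best constant left over.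
  · refine ⟨α₀ / 2, by positivity, fun u _ => ?_⟩
    have hLe : L = α₀ + C ^ 2 * |c₀| ^ 2 / α₀ := by
      rw [hL, RobinForm.shift, if_pos hneg]
    have h1 := mul_le_mul_of_nonpos_left (hC u) hneg.le
    have h2 := RobinForm.norm_sq_H1 u
    have h3 : C ^ 2 * |c₀| ^ 2 / α₀ * ‖RobinForm.fn u‖ ^ 2 +
        c₀ * (C * ‖RobinForm.fn u‖ * ‖u‖) + α₀ / 4 * ‖u‖ ^ 2 =
        (C * c₀ * ‖RobinForm.fn u‖ + α₀ / 2 * ‖u‖) ^ 2 / α₀ := by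
      rw [sq_abs]
      field_simp
      ring
    have h4 : 0 ≤ (C * c₀ * ‖RobinForm.fn u‖ + α₀ / 2 * ‖u‖) ^ 2 / α₀ := by positivity
    have h5 : 0 ≤ α₀ * ‖u‖ ^ 2 := by positivity
    rw [hLe]
    have h6 : α₀ * ‖u‖ ^ 2 = α₀ * ‖RobinForm.fn u‖ ^ 2 + α₀ * ‖RobinForm.grad u‖ ^ 2 := by
      rw [h2, mul_add]
    linarith
  · by_cases hD : 0 < RobinForm.surfaceMeasure Ω ΓD
    · have hLe : L = 0 := by
        rw [hL, RobinForm.shift, if_neg (not_lt.2 hnonneg), if_pos hD]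
      obtain ⟨F, hF, hFr⟩ := hΩ.exists_friedrichs hD.ne'
      -- Friedrichs gives `‖u‖²_{H¹} ≤ (F + 1) ‖∇u‖²`.
      refine ⟨α₀ / (F.toReal + 1), by positivity, fun u hu => ?_⟩
      have h1 : ‖RobinForm.fn u‖ ^ 2 ≤ F.toReal * ‖RobinForm.grad u‖ ^ 2 := by
        rw [Lp.norm_def, Lp.norm_def, ← ENNReal.toReal_pow, ← ENNReal.toReal_pow,
          ← ENNReal.toReal_mul]
        exact ENNReal.toReal_mono (ENNReal.mul_ne_top hF
          (ENNReal.pow_ne_top (Lp.eLpNorm_ne_top _))) (hFr u hu)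
      have h2 : α₀ / (F.toReal + 1) * ‖u‖ ^ 2 ≤ α₀ * ‖RobinForm.grad u‖ ^ 2 := by
        rw [div_mul_eq_mul_div, div_le_iff₀ (by positivity), mul_assoc]
        refine mul_le_mul_of_nonneg_left ?_ hα₀.le
        rw [RobinForm.norm_sq_H1]
        linarith
      have h3 := mul_nonneg hnonneg (hS u)
      rw [hLe]
      linarith
    · have hLe : L = α₀ := by
        rw [hL, RobinForm.shift, if_neg (not_lt.2 hnonneg), if_neg hD]
      refine ⟨α₀, hα₀, fun u _ => ?_⟩
      have h3 := mul_nonneg hnonneg (hS u)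
      rw [hLe, RobinForm.norm_sq_H1, mul_add]
      linarith
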